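/- Let $M$ be a smooth $6$-manifold with a nearly Kähler structure $(h,J)$: $h$ is a smooth Riemannian metric, $J$ a smooth almost complex structure ($J^2=-\mathrm{Id}$) with $h(J\cdot,J\cdot)=h$, and the fundamental $2$-form $F(\cdot,\cdot)=h(J\cdot,\cdot)$ satisfies $D^hF=\frac13\,dF$, where $D^h$ is the Levi-Civita connection of $h$. A $2$-form $\omega$ on an open set $U\subseteq M$ is symplectic if it is smooth, closed and nondegenerate; $J$ is compatible with $\omega$ on $U$ if the bilinear form $g(\cdot,\cdot)=\omega(\cdot,J\cdot)$ is symmetric and positive definite on $U$. Suppose that $J$ is not integrable, i.e. its Nijenhuis tensor $N(X,Y)=[JX,JY]-J[JX,Y]-J[X,JY]-[X,Y]$ does not vanish identically on $M$. Then $J$ is not compatible with any symplectic form on $M$. If moreover $M$ is connected, then $J$ is not compatible with any symplectic form even locally: for every $p\in M$ and every open neighbourhood $U$ of $p$, there is no symplectic form on $U$ with which $J$ is compatible. In particular, let $S^6\subset\mathbb R^7=\operatorname{Im}\mathbb O$ be the unit sphere with its standard almost complex structure $J_p v=p\times v$ for $v\in T_pS^6=p^\perp$, where $\times$ is the seven-dimensional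 cross product, normalized by $e_i\times e_{i+1}=e_{i+3}$ and its cyclic rotations (indices modulo $7$). Then there is no nonempty open set $U\subseteq S^6$ carrying a symplectic form with which this $J$ is compatible. -/

import Mathlib

open Bundle
open scoped Manifold ContDiff

noncomputable section

section General

variable {M : Type*} [TopologicalSpace M] [ChartedSpace (EuclideanSpace ℝ (Fin 6)) M]

/-- The model space `ℝ⁶`. -/
abbrev E6 : Type := EuclideanSpace ℝ (Fin 6)

/-- Vector fields on a 6-manifold (no regularity imposed). -/
abbrev VField (M : Type*) [TopologicalSpace M] [ChartedSpace E6 M] : Type _ :=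
  Π x : M, TangentSpace (𝓡 6) x

/-- Fields of endomorphisms of the tangent bundle. -/
abbrev EndField (M : Type*) [TopologicalSpace M] [ChartedSpace E6 M] : Type _ :=
  Π x : M, TangentSpace (𝓡 6) x →L[ℝ] TangentSpace (𝓡 6) x

/-- Fields of bilinear forms on the tangent bundle. -/
abbrev BilinField (M : Type*) [TopologicalSpace M] [ChartedSpace E6 M] : Type _ :=
  Π x : M, TangentSpace (𝓡 6) x →L[ℝ] TangentSpace (𝓡 6) x →L[ℝ] ℝ

/-- The vector field `X` is differentiable at `x`. -/
def VField.DiffAt [IsManifold (𝓡 6) ∞ M] (X : VField M) (x : M) : Prop :=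
  MDifferentiableAt (𝓡 6) ((𝓡 6).prod 𝓘(ℝ, E6))
    (fun y ↦ TotalSpace.mk' E6 (E := fun z : M ↦ TangentSpace (𝓡 6) z) y (X y)) x

/-- The derivative `X(f)` of a function along a vector field, at `x`. -/
def lieDerivFun (X : VField M) (f : M → ℝ) (x : M) : ℝ :=
  mvfderiv (𝓡 6) f x (X x)

/-- The exterior derivative of a 2-form, evaluated on vector fields:
`dΩ(X,Y,Z) = X Ω(Y,Z) - Y Ω(X,Z) + Z Ω(X,Y) - Ω([X,Y],Z) + Ω([X,Z],Y) - Ω([Y,Z],X)`. -/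
def extDerivTwo (Ω : BilinField M) (X Y Z : VField M) (x : M) : ℝ :=
  lieDerivFun X (fun y ↦ Ω y (Y y) (Z y)) x
    - lieDerivFun Y (fun y ↦ Ω y (X y) (Z y)) x
    + lieDerivFun Z (fun y ↦ Ω y (X y) (Y y)) x
    - Ω x (VectorField.mlieBracket (𝓡 6) X Y x) (Z x)
    + Ω x (VectorField.mlieBracket (𝓡 6) X Z x) (Y x)
    - Ω x (VectorField.mlieBracket (𝓡 6) Y Z x) (X x)

/-- A smooth almost complex structure: a smooth field of endomorphisms with `J² = -1`. -/
structure IsAlmostComplex [IsManifold (𝓡 6) ∞ M] (J : EndField M) : Prop where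
  sq : ∀ (x : M) (v : TangentSpace (𝓡 6) x), J x (J x v) = -v
  smooth : ContMDiff (𝓡 6) ((𝓡 6).prod 𝓘(ℝ, E6 →L[ℝ] E6)) ∞
    (fun x ↦ TotalSpace.mk' (E6 →L[ℝ] E6)
      (E := fun z : M ↦ TangentSpace (𝓡 6) z →L[ℝ] TangentSpace (𝓡 6) z) x (J x))

/-- The Nijenhuis tensor `[JX,JY] - J[JX,Y] - J[X,JY] - [X,Y]` (up to the choice of a constant
factor), evaluated on vector fields. -/
def nijenhuis (J : EndField M) (X Y : VField M) (x : M) : TangentSpace (𝓡 6) x :=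
  VectorField.mlieBracket (𝓡 6) (fun y ↦ J y (X y)) (fun y ↦ J y (Y y)) x
    - J x (VectorField.mlieBracket (𝓡 6) (fun y ↦ J y (X y)) Y x)
    - J x (VectorField.mlieBracket (𝓡 6) X (fun y ↦ J y (Y y)) x)
    - VectorField.mlieBracket (𝓡 6) X Y x

/-- `J` is integrable: its Nijenhuis tensor vanishes identically. -/
def IsIntegrable [IsManifold (𝓡 6) ∞ M] (J : EndField M) : Prop :=
  ∀ (x : M) (X Y : VField M), X.DiffAt x → Y.DiffAt x → nijenhuis J X Y x = 0

/-- Smooth Riemannian metrics on a 6-manifold. -/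
abbrev RMetric (M : Type*) [TopologicalSpace M] [ChartedSpace E6 M] [IsManifold (𝓡 6) ∞ M] :
    Type _ :=
  ContMDiffRiemannianMetric (𝓡 6) ∞ E6 (fun x : M ↦ TangentSpace (𝓡 6) x)

/-- The connection `D` is the Levi-Civita connection of `h`: it is metric and torsion-free. -/
def IsLeviCivita [IsManifold (𝓡 6) ∞ M] (h : RMetric M)
    (D : CovariantDerivative (𝓡 6) E6 (fun x : M ↦ TangentSpace (𝓡 6) x)) : Prop :=
  letI : RiemannianBundle (fun x : M ↦ TangentSpace (𝓡 6) x) := ⟨h.toRiemannianMetric⟩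
  D.IsMetricCompatible ∧ D.torsion = 0

/-- The covariant derivative of a bilinear form:
`(D_X B)(Y,Z) = X B(Y,Z) - B(D_X Y,Z) - B(Y,D_X Z)`. -/
def covDerivBilin [IsManifold (𝓡 6) ∞ M]
    (D : CovariantDerivative (𝓡 6) E6 (fun x : M ↦ TangentSpace (𝓡 6) x))
    (B : BilinField M) (X Y Z : VField M) (x : M) : ℝ :=
  lieDerivFun X (fun y ↦ B y (Y y) (Z y)) x
    - B x (D Y x (X x)) (Z x) - B x (Y x) (D Z x (X x))

/-- The fundamental 2-form `F(X,Y) = h(JX,Y)`. -/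
def fundForm [IsManifold (𝓡 6) ∞ M] (h : RMetric M) (J : EndField M) : BilinField M :=
  fun x ↦ (h.inner x).comp (J x)

/-- `(h,J)` is an almost Hermitian structure. -/
structure IsAlmostHermitian [IsManifold (𝓡 6) ∞ M] (h : RMetric M) (J : EndField M) :
    Prop where
  almostComplex : IsAlmostComplex J
  invariant : ∀ (x : M) (v w : TangentSpace (𝓡 6) x),
    h.inner x (J x v) (J x w) = h.inner x v w

/-- `(h,J)` is nearly Kähler: it is almost Hermitian and `D^h F = (1/3) dF`, where `D^h` is the
Levi-Civita connection of `h` and `F` the fundamental 2-form. -/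
structure IsNearlyKahler [IsManifold (𝓡 6) ∞ M] (h : RMetric M) (J : EndField M) :
    Prop where
  almostHermitian : IsAlmostHermitian h J
  nearlyKahler : ∃ D : CovariantDerivative (𝓡 6) E6 (fun x : M ↦ TangentSpace (𝓡 6) x),
    IsLeviCivita h D ∧
    ∀ (x : M) (X Y Z : VField M), X.DiffAt x → Y.DiffAt x → Z.DiffAt x →
      covDerivBilin D (fundForm h J) X Y Z x = (1 / 3) * extDerivTwo (fundForm h J) X Y Z x

/-- `Ω` (defined on all of `M`, but with meaning only on `U`) is a smooth symplectic form on the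
open set `U`: a smooth, closed, nondegenerate 2-form. -/
structure IsSymplecticOn [IsManifold (𝓡 6) ∞ M] (Ω : BilinField M) (U : Set M) : Prop where
  smooth : ContMDiffOn (𝓡 6) ((𝓡 6).prod 𝓘(ℝ, E6 →L[ℝ] E6 →L[ℝ] ℝ)) ∞
    (fun x ↦ TotalSpace.mk' (E6 →L[ℝ] E6 →L[ℝ] ℝ)
      (E := fun z : M ↦ TangentSpace (𝓡 6) z →L[ℝ] TangentSpace (𝓡 6) z →L[ℝ] ℝ) x (Ω x)) U
  alternating : ∀ x ∈ U, ∀ v : TangentSpace (𝓡 6) x, Ω x v v = 0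
  nondegenerate : ∀ x ∈ U, ∀ v : TangentSpace (𝓡 6) x,
    (∀ w : TangentSpace (𝓡 6) x, Ω x v w = 0) → v = 0
  closed : ∀ x ∈ U, ∀ X Y Z : VField M, X.DiffAt x → Y.DiffAt x → Z.DiffAt x →
    extDerivTwo Ω X Y Z x = 0

/-- `J` is `Ω`-compatible on `U`: the bilinear form `g(v,w) = Ω(v,Jw)` is symmetric and
positive definite. -/
structure IsCompatibleOn (J : EndField M) (Ω : BilinField M) (U : Set M) : Prop where
  symm : ∀ x ∈ U, ∀ v w : TangentSpace (𝓡 6) x, Ω x v (J x w) = Ω x w (J x v)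
  pos : ∀ x ∈ U, ∀ v : TangentSpace (𝓡 6) x, v ≠ 0 → 0 < Ω x v (J x v)

/-- There is a symplectic form on the open set `U` compatible with `J`. -/
def AdmitsCompatibleSymplecticOn [IsManifold (𝓡 6) ∞ M] (J : EndField M) (U : Set M) : Prop :=
  ∃ Ω : BilinField M, IsSymplecticOn Ω U ∧ IsCompatibleOn J Ω U

end General

section Sphere

/-- The space `ℝ⁷` of imaginary octonions. -/
abbrev E7 : Type := EuclideanSpace ℝ (Fin 7)

/-- The seven-dimensional cross product (imaginary part of the octonion product), given on the
standard basis by `eᵢ × eᵢ₊₁ = eᵢ₊₃` and its cyclic rotations, indices modulo 7. -/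
def cross7 (x y : E7) : E7 :=
  WithLp.toLp 2 fun k ↦
    (x (k + 1) * y (k + 3) - x (k + 3) * y (k + 1))
      + (x (k + 2) * y (k + 6) - x (k + 6) * y (k + 2))
      + (x (k + 4) * y (k + 5) - x (k + 5) * y (k + 4))

/-- Left multiplication `y ↦ x × y` as a linear map. -/
def cross7L (x : E7) : E7 →ₗ[ℝ] E7 where
  toFun := cross7 x
  map_add' y z := by ext k; simp [cross7]; ring
  map_smul' c y := by ext k; simp [cross7]; ring

theorem inner_cross7_left (x y : E7) : inner ℝ x (cross7 x y) = 0 := by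
  simp only [cross7, PiLp.inner_apply, Fin.sum_univ_seven, RCLike.inner_apply, conj_trivial,
    Fin.isValue, Fin.reduceAdd, zero_add]
  ring

/-- The unit sphere `S⁶` of `ℝ⁷`. -/
abbrev S6 : Type := Metric.sphere (0 : E7) 1

instance factFinrankE7 : Fact (Module.finrank ℝ E7 = 6 + 1) := ⟨by simp⟩

/-- The inclusion `S⁶ → ℝ⁷` identifies the tangent space at `p` with the hyperplane `p^⊥`. -/
def tangentEquivS6 (p : S6) : TangentSpace (𝓡 6) p ≃ₗ[ℝ] (Submodule.span ℝ {(p : E7)})ᗮ :=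
  (LinearEquiv.ofInjective (mvfderiv (𝓡 6) ((↑) : S6 → E7) p).toLinearMap
      (injective_mvfderiv_subtypeVal_sphere p)).trans
    (LinearEquiv.ofEq _ _ (range_mvfderiv_subtypeVal p))

/-- `y ↦ p × y` as an endomorphism of `p^⊥`. -/
def cross7Perp (p : S6) :
    (Submodule.span ℝ {(p : E7)})ᗮ →ₗ[ℝ] (Submodule.span ℝ {(p : E7)})ᗮ :=
  (cross7L p).restrict fun y _ ↦
    Submodule.mem_orthogonal_singleton_iff_inner_right.2 (inner_cross7_left p y)

/-- The standard almost complex structure of `S⁶`: `J_p v = p × v` for `v ∈ T_p S⁶ = p^⊥`. -/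
def standardJ : EndField S6 := fun p ↦
  haveI : T2Space (TangentSpace (𝓡 6) p) := inferInstanceAs (T2Space E6)
  haveI : FiniteDimensional ℝ (TangentSpace (𝓡 6) p) :=
    inferInstanceAs (FiniteDimensional ℝ E6)
  LinearMap.toContinuousLinearMap
    ((tangentEquivS6 p).symm.toLinearMap ∘ₗ cross7Perp p ∘ₗ (tangentEquivS6 p).toLinearMap)

end Sphere

end

/-! Write `K = D J` for the Levi-Civita covariant derivative of `J`. The fundamental form satisfies
`D F = (1/3) dF` exactly when `D F` is alternating, so the nearly Kähler condition says `K(X,X) = 0`,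
and the Nijenhuis tensor is then `N(X,Y) = -4 J K(X,Y)`.

*Pointwise obstruction.* A closed form `Ω` compatible with `J` is `J`-invariant, and the components
of types `(3,0)` and `(0,3)` of `dΩ` show that the cyclic sum of `Ω(N(X,Y),Z)` vanishes
(`sum_apply_nijenhuisChart_eq_zero`). In dimension six, if `K(v,w) ≠ 0` with `w` orthogonal to `v` and
`J v`, then `v`, `w` and `z = K(v,w)` span the tangent space over `ℂ`, and `K(w,z)`, `K(z,v)` are
positive multiples of `v` and `w`. The cyclic sum is thus a combination of `Ω(v,Jv)`, `Ω(w,Jw)` and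
`Ω(z,Jz)` with coefficients of one sign, and it cannot vanish
(`torsion_eq_zero_of_compatible`). So `N` vanishes at every point of the domain of `Ω`.

*Unique continuation.* If the manifold is connected, then `N` vanishes identically as soon as it
vanishes at one point. The symmetries of the curvature tensor and the Ricci identity express the
second covariant derivative of `J` as a quadratic polynomial in `K` (`covDeriv_torsion_eq`). In a
chart this bounds the derivative of `K` by a multiple of `K`, and by Grönwall's inequality the zeros
of `K` form an open set (`IsNearlyKahlerChart.eventually_covDerivEnd_eq_zero`); they also form a
closed one.

*The sphere.* For `S⁶` no metric is needed: differentiating `J v = p × v` in a parametrization gives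
`N(X,Y) = -4 p × (X × Y)` (`fderiv_sphereParam_nijenhuisChart`), and the cyclic sum is evaluated on
`X`, `Y` and `X × Y`, where `Y` is orthogonal to `X` and `p × X`. -/

open scoped Topology

noncomputable section

/-! ### Linear algebra of nearly Kähler structures at a point -/

section Algebra

/-- The pair symmetry of a curvature tensor follows from its skew symmetries and the first Bianchi
identity. -/
theorem curvature_pair_symm {V : Type*} {R : V → V → V → V → ℝ}
    (r1 : ∀ w x y z, R w x y z = -R x w y z) (r2 : ∀ w x y z, R w x y z = -R w x z y)
    (r3 : ∀ w x y z, R w x y z + R x y w z + R y w x z = 0) (w x y z : V) :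
    R w x y z = R y z w x := by
  linarith [r3 w x y z, r3 x y z w, r3 y z w x, r3 z w x y, r1 w x y z, r1 x y w z, r1 y w x z,
    r2 x y z w, r2 y z x w, r1 y z x w, r2 z x y w, r1 z x y w, r1 z x w y,
    r2 y z w x, r2 z w y x, r1 z w y x, r2 w y z x, r1 w y z x, r2 w x z y, r2 x z w y,
    r2 z w x y, r1 w y x z, r2 y w x z, r2 w x y z, r2 x y w z, r1 x z w y, r1 z w x y, r2 w y x z,
    r1 w x z y, r2 z x w y]

/-- A four-tensor that is skew in its middle arguments, compatible with `J` there, and whose skew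
part in the first two arguments satisfies the type conditions `c1` and `c2`, is zero. The tensor
`e` below measures the failure of `b (J w) x y z = b w x y (J z)`; it vanishes, and this makes `b`
symmetric in its first two arguments. A tensor that is symmetric in its first two arguments and
skew in the second and third is zero. -/
theorem eq_zero_of_type_of_skew {V : Type*} {J : V → V} {b : V → V → V → V → ℝ}
    (hJ1 : ∀ w x y z, b (J (J w)) x y z = -b w x y z)
    (hJ4 : ∀ w x y z, b w x y (J (J z)) = -b w x y z)
    (s : ∀ w x y z, b w x y z = -b w y x z)
    (t : ∀ w x y z, b w x (J y) z = b w x y (J z))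
    (c1 : ∀ w x y z, b (J w) x y z - b x (J w) y z = b w (J x) y z - b (J x) w y z)
    (c2 : ∀ w x y z, b w x y (J z) - b x w y (J z) + b w (J x) y z - b (J x) w y z = 0)
    (w x y z : V) : b w x y z = 0 := by
  have t' : ∀ w x y z, b w (J x) y z = b w x y (J z) := fun w x y z ↦ by
    rw [s, t, s, neg_neg]
  obtain ⟨e, he⟩ : ∃ e : V → V → V → V → ℝ,
      ∀ w x y z, e w x y z = b w x y (J z) - b (J w) x y z := ⟨_, fun _ _ _ _ ↦ rfl⟩
  have e1 : ∀ w x y z, e w x y z = -e x w y z := fun w x y z ↦ by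
    linarith [c1 w x y z, t' x w y z, t' w x y z, he w x y z, he x w y z]
  have e2 : ∀ w x y z, e (J w) x y z = -e w x y (J z) := fun w x y z ↦ by
    linarith [he (J w) x y z, he w x y (J z), hJ1 w x y z, hJ4 w x y z]
  have e3 : ∀ w x y z, e w (J x) y z = e w x y (J z) := fun w x y z ↦ by
    linarith [he w (J x) y z, he w x y (J z), t' w x y (J z), t' (J w) x y z]
  have e4 : ∀ w x y z, e (J w) x y z = 0 := fun w x y z ↦ by
    linarith [e1 (J w) x y z, e3 x w y z, e1 x w y (J z), e2 w x y z]
  have e5 : ∀ w x y z, b w x y (J z) = b (J w) x y z := fun w x y z ↦ by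
    have h1 := he w x y (J (J z))
    rw [hJ4, hJ4] at h1
    linarith [e2 w x y (J z), e4 w x y (J z)]
  have e6 : ∀ w x y z, b w x y (J z) = b x w y (J z) := fun w x y z ↦ by
    linarith [c2 w x y z, t' w x y z, e5 x w y z]
  have e7 : ∀ w x y z, b w x y z = b x w y z := fun w x y z ↦ by
    have := e6 w x y (J z); rw [hJ4, hJ4] at this; linarith
  linarith [e7 w x y z, s w x y z, e7 x y w z, s x y w z, e7 y w x z, s y w x z, s x w y z,
    s y x w z, e7 y x w z, e7 w y x z]

variable {E : Type*} [NormedAddCommGroup E] [NormedSpace ℝ E]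

/-- The second covariant derivative of a nearly Kähler structure, at one point: if `K` and `DK` have
the symmetries of the first and second covariant derivatives of `J`, and `R` is a curvature tensor
related to `DK` by the Ricci identity, then `DK` is a quadratic expression in `K`. The skew part of
`DK` in its first two arguments is expressed through the curvature, which gives it the type needed
for `eq_zero_of_type_of_skew` to apply to the difference of `DK` and the quadratic expression. -/
theorem covDeriv_torsion_eq {H : E →L[ℝ] E →L[ℝ] ℝ} {J : E →L[ℝ] E} {K : E →L[ℝ] E →L[ℝ] E}
    {DK : E → E → E → E} {R : E → E → E → E → ℝ}
    (Hsymm : ∀ v w, H v w = H w v) (Hpos : ∀ v, v ≠ 0 → 0 < H v v)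
    (JJ : ∀ v, J (J v) = -v) (HJ : ∀ v w, H (J v) w = -H v (J w))
    (Kskew : ∀ v w, K v w = -K w v) (KJ : ∀ v w, K v (J w) = -J (K v w))
    (HK : ∀ v w z, H (K v w) z = -H (K v z) w)
    (DKneg : ∀ w x y, DK (-w) x y = -DK w x y)
    (DKskew : ∀ w x y, DK w x y = -DK w y x)
    (HDK : ∀ w x y z, H (DK w x y) z = -H (DK w x z) y)
    (DKJ : ∀ w x y, DK w x (J y) = -J (DK w x y) - K x (K w y) - K w (K x y))
    (r1 : ∀ w x y z, R w x y z = -R x w y z) (r2 : ∀ w x y z, R w x y z = -R w x z y)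
    (r3 : ∀ w x y z, R w x y z + R x y w z + R y w x z = 0)
    (rneg : ∀ w x y z, R w x (-y) z = -R w x y z)
    (ricci : ∀ w x y z, H (DK w x y) z - H (DK x w y) z = R w x (J y) z + R w x y (J z))
    (w x y : E) :
    DK w x y = (1 / 2 : ℝ) • J (K w (K x y) + K (K w x) y + K x (K w y)) := by
  have KJ' : ∀ v w, K (J v) w = -J (K v w) := fun v w ↦ by
    rw [Kskew, KJ, Kskew w v, map_neg, neg_neg]
  have rp := curvature_pair_symm r1 r2 r3
  -- `C w x y z` is the antisymmetrization of the second derivative in its first two arguments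
  obtain ⟨C, hC⟩ : ∃ C : E → E → E → E → ℝ,
      ∀ w x y z, C w x y z = R w x (J y) z + R w x y (J z) := ⟨_, fun _ _ _ _ ↦ rfl⟩
  have hCB : ∀ w x y z, H (DK w x y) z - H (DK x w y) z = C w x y z := fun w x y z ↦ by
    rw [ricci, hC]
  have rneg4 : ∀ w x y z, R w x y (-z) = -R w x y z := fun w x y z ↦ by
    rw [r2, rneg, r2 w x z y, neg_neg]
  have s1 : ∀ w x y z, H (DK w x y) z = -H (DK w y x) z := fun w x y z ↦ by
    rw [DKskew, map_neg, neg_apply]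
  have C1 : ∀ w x y z, C w x y z = -C x w y z := fun w x y z ↦ by
    rw [hC, hC, r1 w x, r1 w x]; ring
  have Canti : ∀ w x y z, C w x y z = -C y z w x := fun w x y z ↦ by
    -- the symmetries of `DK` alone relate the three ways of pairing the arguments
    have ha : ∀ w x y z, C w x y z + C y z w x = C w y z x + C z x w y := fun w x y z ↦ by
      simp only [← hCB]
      linarith [s1 w x y z, HDK w x y z, s1 w y z x, HDK w y z x, s1 x w y z, HDK x w y z,
        s1 x y w z, HDK x y w z, s1 y z w x, HDK y z w x, s1 y w z x, HDK y w z x, s1 z y w x,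
        HDK z y w x, s1 z x w y, HDK z x w y, s1 z w y x, HDK z w y x, s1 x z w y, HDK x z w y,
        s1 z w x y, s1 y w x z, HDK y w x z, HDK z w x y, s1 x w z y, HDK x w z y, s1 w z x y,
        HDK w z x y]
    -- the sum of the three pairings vanishes by the Bianchi identity
    have h0 : (C w x y z + C y z w x) + (C w y z x + C z x w y) + (C w z x y + C x y w z) = 0 := by
      simp only [hC]
      linarith [r3 w x y (J z), r3 w y z (J x), r3 w z x (J y), r3 x y z (J w),
        rp w x (J y) z, rp w x y (J z), rp y z (J w) x, rp y z w (J x), rp w y (J z) x,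
        rp w y z (J x), rp z x (J w) y, rp z x w (J y), rp w z (J x) y, rp w z x (J y),
        rp x y (J w) z, rp x y w (J z), r2 w x (J y) z, r2 y z (J w) x, r2 w y (J z) x,
        r2 z x (J w) y, r2 w z (J x) y, r2 x y (J w) z, r1 x w y (J z), r1 y w x (J z),
        r1 w z y (J x), r1 z y w (J x), r1 z w x (J y), r1 x z w (J y), r1 w y x (J z),
        r1 y z w (J x), r1 z x w (J y), r1 x w z (J y)]
    linarith [ha w x y z, ha w y z x]
  have C3 : ∀ w x y z, C w x (J y) z = C w x y (J z) := fun w x y z ↦ by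
    rw [hC, hC, JJ, JJ, rneg, rneg4]; ring
  have C4 : ∀ w x y z, C (J w) x y z = C w (J x) y z := fun w x y z ↦ by
    rw [Canti, C3 y z w x, ← Canti]
  have Cneg : ∀ w x y z, C w (-x) y z = -C w x y z := fun w x y z ↦ by
    have h (a b : E) : R w (-x) a b = -R w x a b := by
      rw [rp, rneg4, rp]
    simp only [hC, h]; ring
  have C5 : ∀ w x y z, C w x y (J z) + C w (J x) y z = 0 := fun w x y z ↦ by
    have h1 := C4 w (J x) y (J z)
    have h2 := C4 y (J z) w (J x)
    rw [JJ, Cneg] at h1 h2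
    have e1 := hC (J w) (J x) y (J z)
    have e2 := hC (J y) (J z) w (J x)
    have e3 := hC w x y (J z)
    have e4 := hC y z w (J x)
    rw [JJ, rneg4] at e1 e2 e3 e4
    linarith [Canti w (J x) y z, rp (J w) (J x) (J y) (J z), rp (J w) (J x) y z,
      rp w x (J y) (J z), rp w x y z]
  -- the candidate value of the covariant derivative
  obtain ⟨q, hq⟩ : ∃ q : E → E → E → E, ∀ w x y,
      q w x y = (1 / 2 : ℝ) • J (K w (K x y) + K (K w x) y + K x (K w y)) := ⟨_, fun _ _ _ ↦ rfl⟩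
  obtain ⟨m, hm⟩ : ∃ m : E → E → E → E → ℝ, ∀ a b c d, m a b c d = H (J (K a b)) (K c d) :=
    ⟨_, fun _ _ _ _ ↦ rfl⟩
  obtain ⟨n, hn⟩ : ∃ n : E → E → E → E → ℝ, ∀ a b c d, n a b c d = H (K a b) (K c d) :=
    ⟨_, fun _ _ _ _ ↦ rfl⟩
  have HKJ : ∀ a b c d, H (J (K a (K b c))) d = m b c a d := fun a b c d ↦ by
    rw [hm, HJ, HK, KJ, map_neg, neg_apply, neg_neg, HJ (K b c), Hsymm (K b c), HJ, neg_neg]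
  have m1 : ∀ a b c d, m a b c d = -m b a c d := fun a b c d ↦ by simp [hm, Kskew a b]
  have m2 : ∀ a b c d, m a b c d = -m a b d c := fun a b c d ↦ by simp [hm, Kskew c d]
  have mp : ∀ a b c d, m a b c d = -m c d a b := fun a b c d ↦ by
    rw [hm, hm, HJ, Hsymm]
  have mJ2 : ∀ a b c d, m a (J b) c d = n a b c d := fun a b c d ↦ by simp [hm, hn, KJ, JJ]
  have mJ1 : ∀ a b c d, m (J a) b c d = n a b c d := fun a b c d ↦ by simp [hm, hn, KJ', JJ]
  have mJ4 : ∀ a b c d, m a b c (J d) = -n a b c d := fun a b c d ↦ by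
    simp [hm, hn, KJ, JJ, HJ]
  have mJ3 : ∀ a b c d, m a b (J c) d = -n a b c d := fun a b c d ↦ by
    simp [hm, hn, KJ', JJ, HJ]
  have Hq : ∀ w x y z, H (q w x y) z = (1 / 2) * (m x y w z - m w x y z + m w y x z) :=
    fun w x y z ↦ by
      rw [hq, Kskew (K w x) y]
      simp only [map_add, map_neg, map_smul, add_apply,
        neg_apply, smul_apply, smul_eq_mul, HKJ]
      ring
  have HDKJ : ∀ w x y z, H (DK w x (J y)) z = H (DK w x y) (J z) + n w y x z + n x y w z :=
    fun w x y z ↦ by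
      rw [DKJ]
      simp only [map_sub, map_neg, sub_apply, neg_apply, HJ,
        HK x (K w y), HK w (K x y), hn, Hsymm (K x z), Hsymm (K w z)]
      ring
  have key := eq_zero_of_type_of_skew (J := J) (b := fun w x y z ↦ H (DK w x y) z - H (q w x y) z)
    (fun w x y z ↦ by simp only [hq, JJ, DKneg]; simp; ring)
    (fun w x y z ↦ by simp only [JJ]; simp; ring)
    (fun w x y z ↦ by
      simp only [Hq]; linarith [s1 w x y z, m1 x y w z])
    (fun w x y z ↦ by
      simp only [Hq, HDKJ, mJ2, mJ3, mJ4]; ring)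
    (fun w x y z ↦ by
      simp only [Hq]
      linarith [C4 w x y z, hCB (J w) x y z, hCB w (J x) y z, mJ1 w x y z, mJ2 w x y z,
        m1 (J w) x y z, m1 w (J x) y z])
    (fun w x y z ↦ by
      simp only [Hq]
      linarith [C5 w x y z, hCB w x y (J z), hCB w (J x) y z, mJ4 w x y z, mJ2 w x y z,
        m1 w x y (J z), m1 w (J x) y z])
  rw [← hq]
  by_contra hne
  have h1 := Hpos _ (sub_ne_zero.2 hne)
  have h2 := key w x y (DK w x y - q w x y)
  rw [map_sub H, sub_apply] at h1
  exact h1.ne' h2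

/-- A vector orthogonal to a full orthogonal system of nonzero vectors is zero. -/
theorem eq_zero_of_orthogonal_frame [FiniteDimensional ℝ E] {H : E →L[ℝ] E →L[ℝ] ℝ} {n : ℕ}
    (hE : Module.finrank ℝ E = n) (Hpos : ∀ v, v ≠ 0 → 0 < H v v) {u : Fin n → E}
    (hu0 : ∀ i, u i ≠ 0) (hu : ∀ i j, i ≠ j → H (u i) (u j) = 0) {x : E}
    (hx : ∀ i, H (u i) x = 0) : x = 0 := by
  let B : E →ₗ[ℝ] E →ₗ[ℝ] ℝ := ContinuousLinearMap.coeLM ℝ ∘ₗ H.toLinearMap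
  have hli : LinearIndependent ℝ u :=
    LinearMap.linearIndependent_of_isOrthoᵢ (B := B) (fun i j hij ↦ hu i j hij)
      fun i ↦ (Hpos _ (hu0 i)).ne'
  have hspan := hli.span_eq_top_of_card_eq_finrank' (by simp [hE])
  have h0 : B.flip x = 0 := LinearMap.ext_on_range hspan fun i ↦ hx i
  by_contra hne
  exact (Hpos x hne).ne' (DFunLike.congr_fun h0 x)

/-- The pointwise obstruction in dimension six: a nonzero `K = DJ` of nearly Kähler type gives an
orthogonal complex frame `v, w, z = K v w` in which `K w z` is a positive multiple of `v` and
`K z v` a positive multiple of `w`. The cyclic sum in `hΩ` is then a negative combination of the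
values `Ω x (J x)` on this frame. -/
theorem torsion_eq_zero_of_compatible [FiniteDimensional ℝ E] {H Ω : E →L[ℝ] E →L[ℝ] ℝ}
    {J : E →L[ℝ] E} {K : E →L[ℝ] E →L[ℝ] E} (hE : Module.finrank ℝ E = 6)
    (Hsymm : ∀ v w, H v w = H w v) (Hpos : ∀ v, v ≠ 0 → 0 < H v v)
    (JJ : ∀ v, J (J v) = -v) (HJ : ∀ v w, H (J v) w = -H v (J w))
    (Kskew : ∀ v w, K v w = -K w v) (KJ : ∀ v w, K v (J w) = -J (K v w))
    (HK : ∀ v w z, H (K v w) z = -H (K v z) w)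
    (Ωskew : ∀ v w, Ω v w = -Ω w v) (Ωpos : ∀ v, v ≠ 0 → 0 < Ω v (J v))
    (hΩ : ∀ v w z, Ω (J (K v w)) z + Ω (J (K w z)) v + Ω (J (K z v)) w = 0) : K = 0 := by
  have KJ' : ∀ v w, K (J v) w = -J (K v w) := fun v w ↦ by
    rw [Kskew, KJ, Kskew w v, map_neg, neg_neg]
  have Kself (v) : K v v = 0 := by
    have := Kskew v v
    rwa [eq_neg_iff_add_eq_zero, ← two_smul ℝ, smul_eq_zero_iff_right two_ne_zero] at this
  have HJself (v) : H v (J v) = 0 := by linarith [HJ v v, Hsymm (J v) v]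
  have HKself (v w) : H (K v w) w = 0 := by linarith [HK v w w]
  have HKself' (v w) : H (K v w) v = 0 := by
    rw [Kskew, map_neg, neg_apply, HKself, neg_zero]
  by_contra hK
  obtain ⟨v, w₀, hvw₀⟩ : ∃ v w, K v w ≠ 0 := by
    by_contra! h; exact hK (by ext v w; simp [h])
  have hv : v ≠ 0 := by rintro rfl; simp at hvw₀
  have ha := Hpos v hv
  -- make the second vector orthogonal to the complex line through the first
  obtain ⟨w, hvw, hwv, hwJv⟩ : ∃ w, K v w ≠ 0 ∧ H v w = 0 ∧ H (J v) w = 0 := by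
    refine ⟨w₀ - (H v w₀ / H v v) • v - (H (J v) w₀ / H v v) • J v, ?_, ?_, ?_⟩
    · simpa [KJ, Kself] using hvw₀
    · simp [HJself]; field_simp; ring
    · have : H (J v) (J v) = H v v := by rw [HJ, JJ]; simp
      simp [this, Hsymm (J v) v, HJself]; field_simp; ring
  have hw : w ≠ 0 := by rintro rfl; simp at hvw
  have hb := Hpos w hw
  obtain ⟨z, hz⟩ : ∃ z, z = K v w := ⟨_, rfl⟩
  have hz0 : z ≠ 0 := hz ▸ hvw
  have hc := Hpos z hz0
  have hJ0 (x : E) (hx : x ≠ 0) : J x ≠ 0 := fun h ↦ hx (by simpa [h] using JJ x)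
  have hzv : H z v = 0 := by rw [hz, HKself']
  have hzw : H z w = 0 := by rw [hz, HKself]
  have hzJv : H (J z) v = 0 := by rw [hz, ← neg_eq_zero, ← neg_apply, ← map_neg, ← KJ, HKself']
  have hzJw : H (J z) w = 0 := by rw [hz, ← neg_eq_zero, ← neg_apply, ← map_neg, ← KJ', HKself]
  have hJself (a : E) : H (J a) a = 0 := by rw [Hsymm, HJself]
  have hJvz : H (J v) z = 0 := by rw [HJ, Hsymm, hzJv, neg_zero]
  have hJwz : H (J w) z = 0 := by rw [HJ, Hsymm, hzJw, neg_zero]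
  have hJwv : H (J w) v = 0 := by rw [HJ, Hsymm, hwJv, neg_zero]
  have ortho (x : E) (h1 : H v x = 0) (h2 : H (J v) x = 0) (h3 : H w x = 0) (h4 : H (J w) x = 0)
      (h5 : H z x = 0) (h6 : H (J z) x = 0) : x = 0 := by
    refine eq_zero_of_orthogonal_frame hE Hpos (u := ![v, J v, w, J w, z, J z]) ?_ ?_ ?_
    · intro i; fin_cases i <;> simp [hv, hw, hz0, hJ0]
    · have hHJ' (a b : E) : H a (J b) = - H (J a) b := by rw [HJ, neg_neg]
      intro i j hij
      fin_cases i <;> fin_cases j <;>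
        simp [hHJ', JJ, hwv, hwJv, hzv, hzw, hzJv, hzJw, Hsymm v z, Hsymm w z, Hsymm w v, hJself,
          hJvz, hJwz, hJwv] at hij ⊢
    · intro i; fin_cases i <;> simp [h1, h2, h3, h4, h5, h6]
  have hwv' : H w v = 0 := by rw [Hsymm, hwv]
  have hKJ (a b c : E) : H (J a) (K b c) = -H (J c) (K b a) := by
    rw [Hsymm, HK, KJ, map_neg, neg_apply, neg_neg, Hsymm, HJ, neg_neg]
  have hKs (a b : E) : H (J a) (K a b) = 0 := by rw [hKJ, Kself, map_zero, neg_zero]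
  have hKs' (a b : E) : H (J a) (K b a) = 0 := by rw [Kskew, map_neg, hKs, neg_zero]
  -- `K w z` and `K z v` are compared with their claimed values along each vector of the frame
  have hwz' : K w z = (H z z / H v v) • v := by
    rw [← sub_eq_zero]
    apply ortho <;> rw [map_sub, map_smul, smul_eq_mul]
    · rw [Hsymm, HK, Kskew w v, ← hz, map_neg, neg_apply, neg_neg, div_mul_cancel₀ _ ha.ne',
        sub_self]
    · rw [hKJ, Kskew w v, ← hz, map_neg, hJself, hJself]; simp
    · rw [Hsymm, HKself', hwv']; simp
    · rw [hKs, hJwv]; simp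
    · rw [Hsymm, HKself, hzv]; simp
    · rw [hKs', hzJv]; simp
  have hzv' : K z v = (H z z / H w w) • w := by
    rw [← sub_eq_zero]
    apply ortho <;> rw [map_sub, map_smul, smul_eq_mul]
    · rw [Hsymm, HKself, hwv]; simp
    · rw [hKs', hwJv]; simp
    · rw [Hsymm, Kskew, map_neg, neg_apply, HK, ← hz, neg_neg, div_mul_cancel₀ _ hb.ne', sub_self]
    · rw [hKJ, Kskew z w, map_neg, hKJ, hJself, Kskew w v, ← hz]; simp [hJself]
    · rw [Hsymm, HKself', hzw]; simp
    · rw [hKs, hzJw]; simp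
  have := hΩ v w z
  have h1 := Ωpos v hv
  have h2 := Ωpos w hw
  have h3 := Ωpos z hz0
  rw [← hz, hwz', hzv', map_smul, map_smul, map_smul, map_smul, smul_apply, smul_apply, Ωskew (J z),
    Ωskew (J v), Ωskew (J w), smul_eq_mul, smul_eq_mul] at this
  have h4 := mul_pos (div_pos hc ha) h1
  have h5 := mul_pos (div_pos hc hb) h2
  linarith

end Algebra

/-! ### Nearly Kähler structures on open subsets of a vector space -/

section Calculus

set_option maxSynthPendingDepth 3

variable {E : Type*} [NormedAddCommGroup E] [NormedSpace ℝ E]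

/-- The covariant derivative of a field of endomorphisms `J` of a vector space, for the connection
with Christoffel symbols `Γ`; `covDerivEnd J Γ u x y` is `(D_x J) y` at `u`. -/
def covDerivEnd (J : E → E →L[ℝ] E) (Γ : E → E →L[ℝ] E →L[ℝ] E) (u : E) : E →L[ℝ] E →L[ℝ] E :=
  fderiv ℝ J u + ((ContinuousLinearMap.compL ℝ E E E).flip (J u)).comp (Γ u)
    - (ContinuousLinearMap.compL ℝ E E E (J u)).comp (Γ u)

theorem covDerivEnd_apply (J : E → E →L[ℝ] E) (Γ : E → E →L[ℝ] E →L[ℝ] E) (u x y : E) :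
    covDerivEnd J Γ u x y = fderiv ℝ J u x y + Γ u x (J u y) - J u (Γ u x y) := by
  simp [covDerivEnd]

theorem ContDiffAt.covDerivEnd {J : E → E →L[ℝ] E} {Γ : E → E →L[ℝ] E →L[ℝ] E} {u : E}
    (hJ : ContDiffAt ℝ ∞ J u) (hΓ : ContDiffAt ℝ ∞ Γ u) :
    ContDiffAt ℝ ∞ (covDerivEnd J Γ) u := by
  have h1 : ContDiffAt ℝ ∞ (fderiv ℝ J) u := hJ.fderiv_right (by simp)
  unfold _root_.covDerivEnd
  exact (h1.add (ContDiffAt.clm_comp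
    ((ContinuousLinearMap.contDiff _).contDiffAt.comp u hJ) hΓ)).sub
    (ContDiffAt.clm_comp ((ContinuousLinearMap.contDiff _).contDiffAt.comp u hJ) hΓ)

/-- A metric `H` and a field of endomorphisms `J` on the open set `V` of a vector space form a nearly
Kähler structure, and `Γ` are the Christoffel symbols of the Levi-Civita connection of `H`. The
last field says `(D_x J) x = 0`. -/
structure IsNearlyKahlerChart (V : Set E) (H : E → E →L[ℝ] E →L[ℝ] ℝ) (J : E → E →L[ℝ] E)
    (Γ : E → E →L[ℝ] E →L[ℝ] E) : Prop where
  isOpen : IsOpen V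
  contDiffAt_H : ∀ u ∈ V, ContDiffAt ℝ ∞ H u
  contDiffAt_J : ∀ u ∈ V, ContDiffAt ℝ ∞ J u
  contDiffAt_Γ : ∀ u ∈ V, ContDiffAt ℝ ∞ Γ u
  symm : ∀ u ∈ V, ∀ x y, H u x y = H u y x
  pos : ∀ u ∈ V, ∀ x, x ≠ 0 → 0 < H u x x
  sq : ∀ u ∈ V, ∀ x, J u (J u x) = -x
  skew : ∀ u ∈ V, ∀ x y, H u (J u x) y = -H u x (J u y)
  torsionFree : ∀ u ∈ V, ∀ x y, Γ u x y = Γ u y x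
  metric : ∀ u ∈ V, ∀ w x y, fderiv ℝ H u w x y = H u (Γ u w x) y + H u x (Γ u w y)
  nearlyKahler : ∀ u ∈ V, ∀ x, covDerivEnd J Γ u x x = 0

namespace IsNearlyKahlerChart

variable {V : Set E} {H : E → E →L[ℝ] E →L[ℝ] ℝ} {J : E → E →L[ℝ] E}
    {Γ : E → E →L[ℝ] E →L[ℝ] E} (h : IsNearlyKahlerChart V H J Γ) {u : E}

include h

theorem covDerivEnd_swap (hu : u ∈ V) (x y : E) :
    covDerivEnd J Γ u x y = -covDerivEnd J Γ u y x := by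
  have := h.nearlyKahler u hu (x + y)
  simp only [map_add, add_apply, h.nearlyKahler u hu, zero_add, add_zero] at this
  rw [eq_neg_iff_add_eq_zero, ← this, add_comm]

theorem hasFDerivAt_J (hu : u ∈ V) : HasFDerivAt J (fderiv ℝ J u) u :=
  ((h.contDiffAt_J u hu).differentiableAt (by simp)).hasFDerivAt

theorem hasFDerivAt_H (hu : u ∈ V) : HasFDerivAt H (fderiv ℝ H u) u :=
  ((h.contDiffAt_H u hu).differentiableAt (by simp)).hasFDerivAt

theorem hasFDerivAt_Γ (hu : u ∈ V) : HasFDerivAt Γ (fderiv ℝ Γ u) u :=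
  ((h.contDiffAt_Γ u hu).differentiableAt (by simp)).hasFDerivAt

theorem hasFDerivAt_K (hu : u ∈ V) :
    HasFDerivAt (covDerivEnd J Γ) (fderiv ℝ (covDerivEnd J Γ) u) u :=
  (((h.contDiffAt_J u hu).covDerivEnd (h.contDiffAt_Γ u hu)).differentiableAt (by simp)).hasFDerivAt

theorem hasFDerivAt_fderiv_J (hu : u ∈ V) :
    HasFDerivAt (fderiv ℝ J) (fderiv ℝ (fderiv ℝ J) u) u :=
  (((h.contDiffAt_J u hu).fderiv_right (m := ∞) (by simp)).differentiableAt (by simp)).hasFDerivAt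

theorem hasFDerivAt_fderiv_H (hu : u ∈ V) :
    HasFDerivAt (fderiv ℝ H) (fderiv ℝ (fderiv ℝ H) u) u :=
  (((h.contDiffAt_H u hu).fderiv_right (m := ∞) (by simp)).differentiableAt (by simp)).hasFDerivAt

omit h in
/-- Two functions that agree on an open set have equal derivatives there. -/
theorem _root_.HasFDerivAt.apply_eq_of_eqOn {F : Type*} [NormedAddCommGroup F] [NormedSpace ℝ F]
    {f g : E → F} {f' g' : E →L[ℝ] F} (hf : HasFDerivAt f f' u) (hg : HasFDerivAt g g' u)
    (hV : IsOpen V) (hu : u ∈ V) (hfg : ∀ v ∈ V, f v = g v) (w : E) : f' w = g' w := by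
  have : f =ᶠ[𝓝 u] g := Filter.eventually_of_mem (hV.mem_nhds hu) hfg
  rw [hf.unique (hg.congr_of_eventuallyEq this)]

theorem fderiv_J_comp (hu : u ∈ V) (w x : E) :
    fderiv ℝ J u w (J u x) + J u (fderiv ℝ J u w x) = 0 := by
  have hJ := h.hasFDerivAt_J hu
  have hx := hJ.clm_apply (hasFDerivAt_const x u)
  simpa [add_comm] using (hJ.clm_apply hx).apply_eq_of_eqOn (hasFDerivAt_const (-x) u) h.isOpen hu
    (fun v hv ↦ h.sq v hv x) w

theorem covDerivEnd_comp (hu : u ∈ V) (x y : E) :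
    covDerivEnd J Γ u x (J u y) = -J u (covDerivEnd J Γ u x y) := by
  have := h.fderiv_J_comp hu x y
  simp only [covDerivEnd_apply, h.sq u hu, map_add, map_sub, map_neg]
  rw [add_eq_zero_iff_eq_neg] at this
  rw [this]; abel

theorem covDerivEnd_skew (hu : u ∈ V) (x y z : E) :
    H u (covDerivEnd J Γ u x y) z = -H u (covDerivEnd J Γ u x z) y := by
  have hJ := h.hasFDerivAt_J hu
  have hH := h.hasFDerivAt_H hu
  have hy := hJ.clm_apply (hasFDerivAt_const y u)
  have hz := hJ.clm_apply (hasFDerivAt_const z u)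
  have := ((hH.clm_apply hy).clm_apply (hasFDerivAt_const z u)).apply_eq_of_eqOn
    ((hH.clm_apply (hasFDerivAt_const y u)).clm_apply hz).neg h.isOpen hu
    (fun v hv ↦ h.skew v hv y z) x
  simp [h.metric u hu] at this
  simp only [covDerivEnd_apply, map_add, map_sub, add_apply, sub_apply]
  linarith [h.skew u hu (Γ u x y) z, h.skew u hu (Γ u x z) y, h.symm u hu (Γ u x (J u z)) y,
    h.symm u hu y (fderiv ℝ J u x z), h.skew u hu y (Γ u x z),
    h.symm u hu (J u y) (Γ u x z), h.symm u hu (J u (Γ u x z)) y]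

theorem fderiv_Γ_symm (hu : u ∈ V) (w x y : E) : fderiv ℝ Γ u w x y = fderiv ℝ Γ u w y x := by
  have hΓ := h.hasFDerivAt_Γ hu
  simpa using ((hΓ.clm_apply (hasFDerivAt_const x u)).clm_apply
    (hasFDerivAt_const y u)).apply_eq_of_eqOn ((hΓ.clm_apply (hasFDerivAt_const y u)).clm_apply
    (hasFDerivAt_const x u)) h.isOpen hu (fun v hv ↦ h.torsionFree v hv x y) w

omit h in
/-- The curvature tensor of the connection with Christoffel symbols `Γ`. -/
def _root_.christoffelCurvature (Γ : E → E →L[ℝ] E →L[ℝ] E) (u w x y : E) : E :=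
  fderiv ℝ Γ u w x y - fderiv ℝ Γ u x w y + Γ u w (Γ u x y) - Γ u x (Γ u w y)

theorem curvature_skew (hu : u ∈ V) (w x y z : E) :
    H u (christoffelCurvature Γ u w x y) z = -H u (christoffelCurvature Γ u w x z) y := by
  have hΓ := h.hasFDerivAt_Γ hu
  have hH := h.hasFDerivAt_H hu
  have key (w x : E) : fderiv ℝ (fderiv ℝ H) u w x y z =
      H u (Γ u w (Γ u x y)) z + H u (Γ u x y) (Γ u w z) + H u (fderiv ℝ Γ u w x y) z
      + H u (Γ u w y) (Γ u x z) + H u y (Γ u w (Γ u x z)) + H u y (fderiv ℝ Γ u w x z) := by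
    have hΓx := hΓ.clm_apply (hasFDerivAt_const x u)
    have hy := hΓx.clm_apply (hasFDerivAt_const y u)
    have hz := hΓx.clm_apply (hasFDerivAt_const z u)
    have := ((((h.hasFDerivAt_fderiv_H hu).clm_apply (hasFDerivAt_const x u)).clm_apply
      (hasFDerivAt_const y u)).clm_apply (hasFDerivAt_const z u)).apply_eq_of_eqOn
      (((hH.clm_apply hy).clm_apply (hasFDerivAt_const z u)).add
        ((hH.clm_apply (hasFDerivAt_const y u)).clm_apply hz)) h.isOpen hu
      (fun v hv ↦ h.metric v hv x y z) w
    simp [h.metric u hu] at this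
    linarith
  have hs : fderiv ℝ (fderiv ℝ H) u w x = fderiv ℝ (fderiv ℝ H) u x w :=
    ((h.contDiffAt_H u hu).isSymmSndFDerivAt (by
      rw [minSmoothness_of_isRCLikeNormedField]; exact ENat.LEInfty.out)).eq w x
  have h1 := key w x
  rw [hs, key x w] at h1
  simp only [christoffelCurvature, map_add, map_sub, add_apply, sub_apply]
  linarith [h.symm u hu y (fderiv ℝ Γ u w x z), h.symm u hu y (fderiv ℝ Γ u x w z),
    h.symm u hu y (Γ u x (Γ u w z)), h.symm u hu y (Γ u w (Γ u x z))]

theorem curvature_bianchi (hu : u ∈ V) (w x y : E) :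
    christoffelCurvature Γ u w x y + christoffelCurvature Γ u x y w
      + christoffelCurvature Γ u y w x = 0 := by
  simp only [christoffelCurvature, h.torsionFree u hu y w, h.torsionFree u hu x w,
    h.torsionFree u hu y x, h.fderiv_Γ_symm hu w y x, h.fderiv_Γ_symm hu x y w,
    h.fderiv_Γ_symm hu y x w]
  abel

omit h in
/-- The second covariant derivative of `J`: `covDerivEndTwo J Γ u w x y` is `(D_w (D J))_x y`. -/
def _root_.covDerivEndTwo (J : E → E →L[ℝ] E) (Γ : E → E →L[ℝ] E →L[ℝ] E) (u w x y : E) : E :=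
  fderiv ℝ (covDerivEnd J Γ) u w x y + Γ u w (covDerivEnd J Γ u x y)
    - covDerivEnd J Γ u (Γ u w x) y - covDerivEnd J Γ u x (Γ u w y)

theorem ricci_identity (hu : u ∈ V) (w x y : E) :
    covDerivEndTwo J Γ u w x y - covDerivEndTwo J Γ u x w y =
      christoffelCurvature Γ u w x (J u y) - J u (christoffelCurvature Γ u w x y) := by
  have hΓ := h.hasFDerivAt_Γ hu
  have hJ := h.hasFDerivAt_J hu
  have key (w x : E) : fderiv ℝ (covDerivEnd J Γ) u w x y =
      fderiv ℝ (fderiv ℝ J) u w x y + fderiv ℝ Γ u w x (J u y) + Γ u x (fderiv ℝ J u w y)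
      - fderiv ℝ J u w (Γ u x y) - J u (fderiv ℝ Γ u w x y) := by
    have hΓx := hΓ.clm_apply (hasFDerivAt_const x u)
    have hy := hΓx.clm_apply (hasFDerivAt_const y u)
    have := (((h.hasFDerivAt_K hu).clm_apply (hasFDerivAt_const x u)).clm_apply
      (hasFDerivAt_const y u)).apply_eq_of_eqOn
      (((((h.hasFDerivAt_fderiv_J hu).clm_apply (hasFDerivAt_const x u)).clm_apply
        (hasFDerivAt_const y u)).add (hΓx.clm_apply (hJ.clm_apply (hasFDerivAt_const y u)))).sub
        (hJ.clm_apply hy)) h.isOpen hu (fun v hv ↦ covDerivEnd_apply J Γ v x y) w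
    simp at this
    rw [this]; abel
  have hs : fderiv ℝ (fderiv ℝ J) u w x = fderiv ℝ (fderiv ℝ J) u x w :=
    ((h.contDiffAt_J u hu).isSymmSndFDerivAt (by
      rw [minSmoothness_of_isRCLikeNormedField]; exact ENat.LEInfty.out)).eq w x
  simp only [covDerivEndTwo, christoffelCurvature, key, covDerivEnd_apply, hs,
    h.torsionFree u hu x w, map_add, map_sub]
  abel

theorem covDerivEndTwo_swap (hu : u ∈ V) (w x y : E) :
    covDerivEndTwo J Γ u w x y = -covDerivEndTwo J Γ u w y x := by
  have hK := h.hasFDerivAt_K hu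
  have := ((hK.clm_apply (hasFDerivAt_const x u)).clm_apply
    (hasFDerivAt_const y u)).apply_eq_of_eqOn ((hK.clm_apply (hasFDerivAt_const y u)).clm_apply
    (hasFDerivAt_const x u)).neg h.isOpen hu (fun v hv ↦ h.covDerivEnd_swap hv x y) w
  simp at this
  simp only [covDerivEndTwo, this, h.covDerivEnd_swap hu x, h.covDerivEnd_swap hu _ y, map_neg]
  abel

theorem covDerivEndTwo_skew (hu : u ∈ V) (w x y z : E) :
    H u (covDerivEndTwo J Γ u w x y) z = -H u (covDerivEndTwo J Γ u w x z) y := by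
  have hK := (h.hasFDerivAt_K hu).clm_apply (hasFDerivAt_const x u)
  have hH := h.hasFDerivAt_H hu
  have := ((hH.clm_apply (hK.clm_apply (hasFDerivAt_const y u))).clm_apply
      (hasFDerivAt_const z u)).apply_eq_of_eqOn
    ((hH.clm_apply (hK.clm_apply (hasFDerivAt_const z u))).clm_apply
      (hasFDerivAt_const y u)).neg h.isOpen hu (fun v hv ↦ h.covDerivEnd_skew hv x y z) w
  simp [h.metric u hu] at this
  simp only [covDerivEndTwo, map_add, map_sub, add_apply, sub_apply]
  linarith [h.covDerivEnd_skew hu (Γ u w x) y z, h.covDerivEnd_skew hu x (Γ u w y) z,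
    h.covDerivEnd_skew hu x (Γ u w z) y]

theorem covDerivEndTwo_comp (hu : u ∈ V) (w x y : E) :
    covDerivEndTwo J Γ u w x (J u y) = -J u (covDerivEndTwo J Γ u w x y)
      - covDerivEnd J Γ u x (covDerivEnd J Γ u w y)
      - covDerivEnd J Γ u w (covDerivEnd J Γ u x y) := by
  have hK := (h.hasFDerivAt_K hu).clm_apply (hasFDerivAt_const x u)
  have hJ := h.hasFDerivAt_J hu
  have := (hK.clm_apply (hJ.clm_apply (hasFDerivAt_const y u))).apply_eq_of_eqOn
    (hJ.clm_apply (hK.clm_apply (hasFDerivAt_const y u))).neg h.isOpen hu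
    (fun v hv ↦ h.covDerivEnd_comp hv x y) w
  simp at this
  have hw (y : E) : fderiv ℝ J u w y = covDerivEnd J Γ u w y - Γ u w (J u y) + J u (Γ u w y) := by
    rw [covDerivEnd_apply]; abel
  rw [hw, hw, map_add, map_sub, h.covDerivEnd_comp hu x (Γ u w y)] at this
  simp only [covDerivEndTwo, map_add, map_sub, h.covDerivEnd_comp hu, map_neg]
  rw [← sub_eq_zero] at this ⊢
  rw [← this]
  abel

theorem covDerivEndTwo_eq (hu : u ∈ V) (w x y : E) :
    covDerivEndTwo J Γ u w x y = (1 / 2 : ℝ) • J u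
      (covDerivEnd J Γ u w (covDerivEnd J Γ u x y) + covDerivEnd J Γ u (covDerivEnd J Γ u w x) y
        + covDerivEnd J Γ u x (covDerivEnd J Γ u w y)) := by
  refine covDeriv_torsion_eq (H := H u) (R := fun w x y z ↦ H u (christoffelCurvature Γ u w x y) z)
    (h.symm u hu) (h.pos u hu) (h.sq u hu) (h.skew u hu) (h.covDerivEnd_swap hu)
    (h.covDerivEnd_comp hu) (h.covDerivEnd_skew hu) ?_ (h.covDerivEndTwo_swap hu)
    (h.covDerivEndTwo_skew hu) (h.covDerivEndTwo_comp hu) ?_ (h.curvature_skew hu) ?_ ?_ ?_ w x y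
  · intro w x y
    simp only [covDerivEndTwo, map_neg, neg_apply]
    abel
  · intro w x y z
    rw [← neg_apply, ← map_neg]
    congr 2
    simp only [christoffelCurvature]
    abel
  · intro w x y z
    rw [← add_apply, ← map_add, ← add_apply, ← map_add, h.curvature_bianchi hu]
    simp
  · intro w x y z
    rw [← neg_apply, ← map_neg]
    congr 2
    simp only [christoffelCurvature, map_neg]
    abel
  · intro w x y z
    rw [← sub_apply, ← map_sub, h.ricci_identity hu, map_sub, sub_apply, h.skew u hu]
    ring

/-- The derivative of `D J` is bounded by a locally bounded multiple of `D J`, because the second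
covariant derivative is quadratic in `D J`. -/
theorem norm_fderiv_covDerivEnd_le (hu : u ∈ V) (w : E) :
    ‖fderiv ℝ (covDerivEnd J Γ) u w‖ ≤
      (3 * ‖Γ u‖ + 2 * ‖J u‖ * ‖covDerivEnd J Γ u‖) * ‖w‖ * ‖covDerivEnd J Γ u‖ := by
  set K := covDerivEnd J Γ u with hK
  have hΓ2 (a b : E) : ‖Γ u a b‖ ≤ ‖Γ u‖ * ‖a‖ * ‖b‖ := (Γ u).le_opNorm₂ a b
  have hK2 (a b : E) : ‖K a b‖ ≤ ‖K‖ * ‖a‖ * ‖b‖ := K.le_opNorm₂ a b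
  refine ContinuousLinearMap.opNorm_le_bound₂ _ (by positivity) fun x y ↦ ?_
  have e1 : fderiv ℝ (covDerivEnd J Γ) u w x y =
      (1 / 2 : ℝ) • J u (K w (K x y) + K (K w x) y + K x (K w y))
      - Γ u w (K x y) + K (Γ u w x) y + K x (Γ u w y) := by
    rw [← h.covDerivEndTwo_eq hu, covDerivEndTwo]
    abel
  have b1 : ‖Γ u w (K x y)‖ ≤ ‖Γ u‖ * ‖w‖ * (‖K‖ * ‖x‖ * ‖y‖) :=
    (hΓ2 _ _).trans (by gcongr; exact hK2 _ _)
  have b2 : ‖K (Γ u w x) y‖ ≤ ‖K‖ * (‖Γ u‖ * ‖w‖ * ‖x‖) * ‖y‖ :=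
    (hK2 _ _).trans (by gcongr; exact hΓ2 _ _)
  have b3 : ‖K x (Γ u w y)‖ ≤ ‖K‖ * ‖x‖ * (‖Γ u‖ * ‖w‖ * ‖y‖) :=
    (hK2 _ _).trans (by gcongr; exact hΓ2 _ _)
  have b4 : ‖K w (K x y)‖ ≤ ‖K‖ * ‖w‖ * (‖K‖ * ‖x‖ * ‖y‖) :=
    (hK2 _ _).trans (by gcongr; exact hK2 _ _)
  have b5 : ‖K (K w x) y‖ ≤ ‖K‖ * (‖K‖ * ‖w‖ * ‖x‖) * ‖y‖ :=
    (hK2 _ _).trans (by gcongr; exact hK2 _ _)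
  have b6 : ‖K x (K w y)‖ ≤ ‖K‖ * ‖x‖ * (‖K‖ * ‖w‖ * ‖y‖) :=
    (hK2 _ _).trans (by gcongr; exact hK2 _ _)
  have b7 : ‖(1 / 2 : ℝ) • J u (K w (K x y) + K (K w x) y + K x (K w y))‖ ≤
      (1 / 2) * (‖J u‖ * (3 * (‖K‖ * ‖K‖ * ‖w‖ * ‖x‖ * ‖y‖))) := by
    rw [norm_smul, Real.norm_of_nonneg (by norm_num : (0 : ℝ) ≤ 1 / 2)]
    gcongr
    refine ((J u).le_opNorm _).trans ?_
    gcongr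
    refine (norm_add₃_le).trans ?_
    linarith
  rw [e1]
  refine (norm_add_le _ _).trans ((add_le_add_left ((norm_add_le _ _).trans
    (add_le_add_left (norm_sub_le _ _) _)) _).trans ?_)
  have : 0 ≤ ‖J u‖ * (‖K‖ * ‖K‖ * ‖w‖ * ‖x‖ * ‖y‖) := by positivity
  linarith

/-- The zeros of `D J` form an open set: along a segment starting at a zero, the derivative of `D J`
is bounded by a multiple of `D J`, so Grönwall's inequality applies. -/
theorem eventually_covDerivEnd_eq_zero (hu : u ∈ V) (h0 : covDerivEnd J Γ u = 0) :
    ∀ᶠ v in 𝓝 u, covDerivEnd J Γ v = 0 := by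
  have cΓ := (h.contDiffAt_Γ u hu).continuousAt.norm
  have cJ := (h.contDiffAt_J u hu).continuousAt.norm
  have cK := ((h.contDiffAt_J u hu).covDerivEnd (h.contDiffAt_Γ u hu)).continuousAt.norm
  have cC := (cΓ.const_mul 3).add ((cJ.const_mul 2).mul cK)
  obtain ⟨C, hC⟩ : ∃ C, C = 3 * ‖Γ u‖ + 2 * ‖J u‖ * ‖covDerivEnd J Γ u‖ + 1 := ⟨_, rfl⟩
  have hlt : ∀ᶠ v in 𝓝 u, 3 * ‖Γ v‖ + 2 * ‖J v‖ * ‖covDerivEnd J Γ v‖ < C ∧ v ∈ V :=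
    (cC.eventually (gt_mem_nhds (by rw [hC]; exact lt_add_one _))).and (h.isOpen.mem_nhds hu)
  obtain ⟨r, hr, hball⟩ := Metric.eventually_nhds_iff_ball.1 hlt
  filter_upwards [Metric.ball_mem_nhds u hr] with v hv
  have hseg (t : ℝ) (ht : t ∈ Set.Icc (0 : ℝ) 1) : u + t • (v - u) ∈ Metric.ball u r := by
    have := (convex_ball u r).add_smul_sub_mem (Metric.mem_ball_self hr) hv ht
    simpa using this
  have hder (t : ℝ) (ht : t ∈ Set.Icc (0 : ℝ) 1) :
      HasDerivAt (fun t : ℝ ↦ covDerivEnd J Γ (u + t • (v - u)))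
        (fderiv ℝ (covDerivEnd J Γ) (u + t • (v - u)) (v - u)) t := by
    have h1 : HasDerivAt (fun t : ℝ ↦ u + t • (v - u)) (v - u) t := by
      simpa using ((hasDerivAt_id t).smul_const (v - u)).const_add u
    exact (h.hasFDerivAt_K (hball _ (hseg t ht)).2).comp_hasDerivAt t h1
  have := eq_zero_of_abs_deriv_le_mul_abs_self_of_eq_zero_right (K := C * ‖v - u‖)
    (fun t ht ↦ (hder t ht).continuousAt.continuousWithinAt)
    (fun t ht ↦ (hder t (Set.Ico_subset_Icc_self ht)).hasDerivWithinAt) (by simpa using h0)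
    (fun t ht ↦ by
      obtain ⟨h1, h2⟩ := hball _ (hseg t (Set.Ico_subset_Icc_self ht))
      refine (h.norm_fderiv_covDerivEnd_le h2 _).trans ?_
      gcongr) 1 (by simp)
  simpa using this

omit h in
/-- The Nijenhuis tensor of a field of endomorphisms of a vector space, on constant fields. -/
def _root_.nijenhuisChart (J : E → E →L[ℝ] E) (u x y : E) : E :=
  fderiv ℝ J u (J u x) y - fderiv ℝ J u (J u y) x + J u (fderiv ℝ J u y x)
    - J u (fderiv ℝ J u x y)

theorem nijenhuisChart_eq (hu : u ∈ V) (x y : E) :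
    nijenhuisChart J u x y = (-4 : ℝ) • J u (covDerivEnd J Γ u x y) := by
  have hw (x y : E) : fderiv ℝ J u x y = covDerivEnd J Γ u x y - Γ u x (J u y) + J u (Γ u x y) := by
    rw [covDerivEnd_apply]; abel
  have h1 : covDerivEnd J Γ u (J u x) y = -J u (covDerivEnd J Γ u x y) := by
    rw [h.covDerivEnd_swap hu, h.covDerivEnd_comp hu, h.covDerivEnd_swap hu y x, map_neg, neg_neg]
  have h2 : covDerivEnd J Γ u (J u y) x = J u (covDerivEnd J Γ u x y) := by
    rw [h.covDerivEnd_swap hu, h.covDerivEnd_comp hu, neg_neg]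
  simp only [nijenhuisChart, hw, h1, h2, map_add, map_sub, h.sq u hu, h.covDerivEnd_swap hu y x,
    h.torsionFree u hu (J u x) y, h.torsionFree u hu (J u y) x,
    h.torsionFree u hu (J u x) (J u y), map_neg, h.torsionFree u hu y x]
  module

theorem nijenhuisChart_eq_zero_iff (hu : u ∈ V) :
    (∀ x y, nijenhuisChart J u x y = 0) ↔ covDerivEnd J Γ u = 0 := by
  constructor
  · intro h0
    ext1 x; ext1 y
    have := h.sq u hu (covDerivEnd J Γ u x y)
    have h1 := h0 x y
    rw [h.nijenhuisChart_eq hu, smul_eq_zero_iff_right (by norm_num)] at h1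
    rw [h1, map_zero] at this
    simpa using this.symm
  · intro h0 x y
    simp [h.nijenhuisChart_eq hu, h0]

end IsNearlyKahlerChart

/-- If `Ω` is closed and `J`-invariant, then the cyclic sum of `Ω (N x y) z` vanishes. It is the
combination of values of `dΩ` that gives the part of type `(3,0) + (0,3)`. -/
theorem sum_apply_nijenhuisChart_eq_zero {V : Set E} (hV : IsOpen V) {u : E} (hu : u ∈ V)
    {J : E → E →L[ℝ] E} {Ω : E → E →L[ℝ] E →L[ℝ] ℝ}
    (hJ : DifferentiableAt ℝ J u) (hΩ : DifferentiableAt ℝ Ω u)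
    (sq : ∀ v ∈ V, ∀ x, J v (J v x) = -x) (alt : ∀ v ∈ V, ∀ x, Ω v x x = 0)
    (symm : ∀ v ∈ V, ∀ x y, Ω v x (J v y) = Ω v y (J v x))
    (closed : ∀ x y z, fderiv ℝ Ω u x y z - fderiv ℝ Ω u y x z + fderiv ℝ Ω u z x y = 0)
    (x y z : E) :
    Ω u (nijenhuisChart J u x y) z + Ω u (nijenhuisChart J u y z) x
      + Ω u (nijenhuisChart J u z x) y = 0 := by
  have skew : ∀ v ∈ V, ∀ x y, Ω v x y = -Ω v y x := fun v hv x y ↦ by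
    have := alt v hv (x + y)
    simp only [map_add, add_apply, alt v hv, zero_add, add_zero] at this
    linarith
  have inv : ∀ v ∈ V, ∀ x y, Ω v (J v x) (J v y) = Ω v x y := fun v hv x y ↦ by
    rw [symm v hv, sq v hv, map_neg, skew v hv x y]
  have hJ' := hJ.hasFDerivAt
  have hΩ' := hΩ.hasFDerivAt
  have hΩs (w x y : E) : fderiv ℝ Ω u w x y = -fderiv ℝ Ω u w y x := by
    simpa using ((hΩ'.clm_apply (hasFDerivAt_const x u)).clm_apply
      (hasFDerivAt_const y u)).apply_eq_of_eqOn ((hΩ'.clm_apply (hasFDerivAt_const y u)).clm_apply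
      (hasFDerivAt_const x u)).neg hV hu (fun v hv ↦ skew v hv x y) w
  have hd (w x y : E) : fderiv ℝ Ω u w (J u x) (J u y) + Ω u (fderiv ℝ J u w x) (J u y)
      + Ω u (J u x) (fderiv ℝ J u w y) = fderiv ℝ Ω u w x y := by
    have := ((hΩ'.clm_apply (hJ'.clm_apply (hasFDerivAt_const x u))).clm_apply
      (hJ'.clm_apply (hasFDerivAt_const y u))).apply_eq_of_eqOn
      ((hΩ'.clm_apply (hasFDerivAt_const x u)).clm_apply
      (hasFDerivAt_const y u)) hV hu (fun v hv ↦ inv v hv x y) w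
    simp at this
    linarith
  have hs := skew u hu
  have hJ1 (w x : E) : fderiv ℝ J u w (J u x) = -J u (fderiv ℝ J u w x) := by
    have := (hJ'.clm_apply (hJ'.clm_apply (hasFDerivAt_const x u))).apply_eq_of_eqOn
      (hasFDerivAt_const (-x) u) hV hu (fun v hv ↦ sq v hv x) w
    simp at this
    rw [eq_neg_iff_add_eq_zero, ← this, add_comm]
  have hd1 (w x y : E) : fderiv ℝ Ω u w (J u x) (J u y) - Ω u (J u (fderiv ℝ J u w x)) y
      + Ω u (J u (fderiv ℝ J u w y)) x = fderiv ℝ Ω u w x y := by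
    rw [← hd w x y, symm u hu _ y, hs y, hs (J u x), symm u hu _ x, hs x]
    ring
  have hd2 (w x y : E) : -fderiv ℝ Ω u w (J u x) y - Ω u (fderiv ℝ J u w x) y
      + Ω u (fderiv ℝ J u w y) x = fderiv ℝ Ω u w x (J u y) := by
    rw [← hd w x (J u y), hJ1, sq u hu, map_neg, map_neg, map_neg, inv u hu, hs x]
    ring
  simp only [nijenhuisChart, map_add, map_sub, add_apply, sub_apply]
  linarith [closed x y z, closed (J u x) (J u y) z, closed x (J u y) (J u z),
    closed (J u x) y (J u z), hd1 x y z, hd1 y x z, hd1 z x y, hd2 (J u x) y z, hd2 (J u y) x z,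
    hd2 (J u z) x y]

end Calculus

/-! ### Tensor fields in a chart -/

section Chart

set_option maxSynthPendingDepth 3

/-- A family of linear maps on a finite-dimensional space is smooth if all its values are. -/
theorem contDiffAt_clm_of_apply {D E F : Type*} [NormedAddCommGroup D] [NormedSpace ℝ D]
    [NormedAddCommGroup E] [NormedSpace ℝ E] [FiniteDimensional ℝ E]
    [NormedAddCommGroup F] [NormedSpace ℝ F] {n : ℕ∞ω} {f : D → E →L[ℝ] F} {u : D}
    (h : ∀ y, ContDiffAt ℝ n (fun x ↦ f x y) u) : ContDiffAt ℝ n f u := by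
  let e₁ : E ≃L[ℝ] (Fin (Module.finrank ℝ E) → ℝ) := ContinuousLinearEquiv.ofFinrankEq (by simp)
  let e₂ := (e₁.arrowCongr (1 : F ≃L[ℝ] F)).trans (ContinuousLinearEquiv.piRing (Fin _))
  rw [← Function.id_comp f, ← e₂.symm_comp_self]
  exact e₂.symm.contDiff.contDiffAt.comp u (contDiffAt_pi.mpr fun i ↦ h _)

variable {M : Type*} [TopologicalSpace M] [ChartedSpace E6 M]

/-- The coordinate frame of the chart at `x₀`, at the point with coordinates `u`: the derivative of
the inverse of the chart. -/
def chartFrame (x₀ : M) (u : E6) :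
    E6 →L[ℝ] TangentSpace (𝓡 6) ((extChartAt (𝓡 6) x₀).symm u) :=
  mfderiv 𝓘(ℝ, E6) (𝓡 6) (extChartAt (𝓡 6) x₀).symm u

/-- The coordinate coframe of the chart at `x₀`: the derivative of the chart at the point with
coordinates `u`. -/
def chartCoframe (x₀ : M) (u : E6) :
    TangentSpace (𝓡 6) ((extChartAt (𝓡 6) x₀).symm u) →L[ℝ] E6 :=
  mfderiv (𝓡 6) 𝓘(ℝ, E6) (extChartAt (𝓡 6) x₀) ((extChartAt (𝓡 6) x₀).symm u)

/-- The vector field with components `ξ` in the chart at `x₀`. Its values outside the domain of the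
chart are of no significance. -/
def fieldOfCoord (x₀ : M) (ξ : E6 → E6) : VField M :=
  VectorField.mpullback (𝓡 6) 𝓘(ℝ, E6) (extChartAt (𝓡 6) x₀) ξ

/-- The components of a vector field in the chart at `x₀`. -/
def coordOfField (x₀ : M) (X : VField M) : E6 → E6 :=
  VectorField.mpullback 𝓘(ℝ, E6) (𝓡 6) (extChartAt (𝓡 6) x₀).symm X

/-- The components of a field of bilinear forms in the chart at `x₀`. -/
def chartBilin (x₀ : M) (Ω : BilinField M) (u : E6) : E6 →L[ℝ] E6 →L[ℝ] ℝ :=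
  let B : E6 →L[ℝ] E6 →L[ℝ] ℝ := Ω ((extChartAt (𝓡 6) x₀).symm u)
  let e : E6 →L[ℝ] E6 := chartFrame x₀ u
  B.bilinearComp e e

/-- The components of a field of endomorphisms in the chart at `x₀`. -/
def chartEnd (x₀ : M) (J : EndField M) (u : E6) : E6 →L[ℝ] E6 :=
  (chartCoframe x₀ u).comp ((J ((extChartAt (𝓡 6) x₀).symm u)).comp (chartFrame x₀ u))

variable [IsManifold (𝓡 6) ∞ M] {x₀ : M} {u : E6}

/-- The vector field `X` is smooth at `x`. -/
def VField.SmoothAt (X : VField M) (x : M) : Prop :=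
  ContMDiffAt (𝓡 6) ((𝓡 6).prod 𝓘(ℝ, E6)) ∞
    (fun y ↦ TotalSpace.mk' E6 (E := fun z : M ↦ TangentSpace (𝓡 6) z) y (X y)) x

/-- The field of bilinear forms `Ω` is smooth at `x`. -/
def BilinField.SmoothAt (Ω : BilinField M) (x : M) : Prop :=
  ContMDiffAt (𝓡 6) ((𝓡 6).prod 𝓘(ℝ, E6 →L[ℝ] E6 →L[ℝ] ℝ)) ∞
    (fun x ↦ TotalSpace.mk' (E6 →L[ℝ] E6 →L[ℝ] ℝ)
      (E := fun z : M ↦ TangentSpace (𝓡 6) z →L[ℝ] TangentSpace (𝓡 6) z →L[ℝ] ℝ) x (Ω x)) x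

/-- The field of endomorphisms `J` is smooth at `x`. -/
def EndField.SmoothAt (J : EndField M) (x : M) : Prop :=
  ContMDiffAt (𝓡 6) ((𝓡 6).prod 𝓘(ℝ, E6 →L[ℝ] E6)) ∞
    (fun x ↦ TotalSpace.mk' (E6 →L[ℝ] E6)
      (E := fun z : M ↦ TangentSpace (𝓡 6) z →L[ℝ] TangentSpace (𝓡 6) z) x (J x)) x

theorem VField.SmoothAt.diffAt {X : VField M} {x : M} (hX : VField.SmoothAt X x) :
    VField.DiffAt X x :=
  ContMDiffAt.mdifferentiableAt hX (by simp)

theorem BilinField.SmoothAt.apply {Ω : BilinField M} {X Y : VField M} {x : M}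
    (hΩ : BilinField.SmoothAt Ω x) (hX : VField.SmoothAt X x) (hY : VField.SmoothAt Y x) :
    ContMDiffAt (𝓡 6) 𝓘(ℝ, ℝ) ∞ (fun y ↦ Ω y (X y) (Y y)) x := by
  have : ContMDiffAt (𝓡 6) ((𝓡 6).prod 𝓘(ℝ)) ∞
      (fun m ↦ TotalSpace.mk' ℝ (E := Bundle.Trivial M ℝ) m (Ω m (X m) (Y m))) x :=
    ContMDiffAt.clm_bundle_apply₂ (F₁ := E6) (F₂ := E6) hΩ hX hY
  simp only [contMDiffAt_totalSpace] at this
  exact this.2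

theorem EndField.SmoothAt.apply {J : EndField M} {X : VField M} {x : M}
    (hJ : EndField.SmoothAt J x) (hX : VField.SmoothAt X x) :
    VField.SmoothAt (fun y ↦ J y (X y)) x :=
  ContMDiffAt.clm_bundle_apply hJ hX

theorem EndField.SmoothAt.apply_diffAt {J : EndField M} {X : VField M} {x : M}
    (hJ : EndField.SmoothAt J x) (hX : VField.DiffAt X x) :
    VField.DiffAt (fun y ↦ J y (X y)) x :=
  MDifferentiableAt.clm_bundle_apply (ContMDiffAt.mdifferentiableAt hJ (by simp)) hX

theorem chartCoframe_chartFrame (hu : u ∈ (extChartAt (𝓡 6) x₀).target) (v : E6) :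
    chartCoframe x₀ u (chartFrame x₀ u v) = v := by
  have := mfderiv_extChartAt_comp_mfderivWithin_extChartAt_symm hu
  rw [(𝓡 6).range_eq_univ, mfderivWithin_univ] at this
  exact DFunLike.congr_fun this v

theorem chartFrame_chartCoframe (hu : u ∈ (extChartAt (𝓡 6) x₀).target)
    (v : TangentSpace (𝓡 6) ((extChartAt (𝓡 6) x₀).symm u)) :
    chartFrame x₀ u (chartCoframe x₀ u v) = v := by
  have := mfderivWithin_extChartAt_symm_comp_mfderiv_extChartAt hu
  rw [(𝓡 6).range_eq_univ, mfderivWithin_univ] at this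
  exact DFunLike.congr_fun this v

theorem fieldOfCoord_apply (hu : u ∈ (extChartAt (𝓡 6) x₀).target) (ξ : E6 → E6) :
    fieldOfCoord x₀ ξ ((extChartAt (𝓡 6) x₀).symm u) = chartFrame x₀ u (ξ u) := by
  have h1 := mfderiv_extChartAt_comp_mfderivWithin_extChartAt_symm hu
  have h2 := mfderivWithin_extChartAt_symm_comp_mfderiv_extChartAt hu
  rw [(𝓡 6).range_eq_univ, mfderivWithin_univ] at h1 h2
  have h3 := ContinuousLinearMap.inverse_eq h1 h2
  have h4 := (extChartAt (𝓡 6) x₀).right_inv hu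
  refine (DFunLike.congr_fun h3 _).trans ?_
  exact congrArg (fun w ↦ chartFrame x₀ u (ξ w)) h4

theorem coordOfField_apply (hu : u ∈ (extChartAt (𝓡 6) x₀).target) (X : VField M) :
    coordOfField x₀ X u = chartCoframe x₀ u (X ((extChartAt (𝓡 6) x₀).symm u)) := by
  have h1 := mfderiv_extChartAt_comp_mfderivWithin_extChartAt_symm hu
  have h2 := mfderivWithin_extChartAt_symm_comp_mfderiv_extChartAt hu
  rw [(𝓡 6).range_eq_univ, mfderivWithin_univ] at h1 h2
  exact DFunLike.congr_fun (ContinuousLinearMap.inverse_eq h2 h1) _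

theorem chartFrame_coordOfField (hu : u ∈ (extChartAt (𝓡 6) x₀).target) (X : VField M) :
    chartFrame x₀ u (coordOfField x₀ X u) = X ((extChartAt (𝓡 6) x₀).symm u) := by
  rw [coordOfField_apply hu, chartFrame_chartCoframe hu]

theorem coordOfField_fieldOfCoord (hu : u ∈ (extChartAt (𝓡 6) x₀).target) (ξ : E6 → E6) :
    coordOfField x₀ (fieldOfCoord x₀ ξ) u = ξ u := by
  rw [coordOfField_apply hu, fieldOfCoord_apply hu, chartCoframe_chartFrame hu]

theorem contMDiffAt_extChartAt_symm' (hu : u ∈ (extChartAt (𝓡 6) x₀).target) :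
    ContMDiffAt 𝓘(ℝ, E6) (𝓡 6) ∞ (extChartAt (𝓡 6) x₀).symm u :=
  (contMDiffOn_extChartAt_symm x₀).contMDiffAt
    ((isOpen_extChartAt_target x₀).mem_nhds hu)

theorem smoothAt_fieldOfCoord (hu : u ∈ (extChartAt (𝓡 6) x₀).target) {ξ : E6 → E6}
    (hξ : ContDiffAt ℝ ∞ ξ u) :
    VField.SmoothAt (fieldOfCoord x₀ ξ) ((extChartAt (𝓡 6) x₀).symm u) := by
  have hs := (extChartAt (𝓡 6) x₀).map_target hu
  refine ContMDiffAt.mpullback_vectorField_preimage (I := 𝓡 6) (I' := 𝓘(ℝ, E6)) (n := ∞) ?_ ?_ ?_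
    (by simp)
  · rw [(extChartAt (𝓡 6) x₀).right_inv hu]
    exact contMDiffAt_vectorSpace_iff_contDiffAt.2 hξ
  · exact contMDiffAt_extChartAt' (by simpa using hs)
  · exact isInvertible_mfderiv_extChartAt hs

theorem isInvertible_mfderiv_extChartAt_symm (hu : u ∈ (extChartAt (𝓡 6) x₀).target) :
    (mfderiv 𝓘(ℝ, E6) (𝓡 6) (extChartAt (𝓡 6) x₀).symm u).IsInvertible := by
  have := isInvertible_mfderivWithin_extChartAt_symm hu
  rwa [(𝓡 6).range_eq_univ, mfderivWithin_univ] at this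

theorem contDiffAt_coordOfField (hu : u ∈ (extChartAt (𝓡 6) x₀).target) {X : VField M}
    (hX : VField.SmoothAt X ((extChartAt (𝓡 6) x₀).symm u)) :
    ContDiffAt ℝ ∞ (coordOfField x₀ X) u :=
  contMDiffAt_vectorSpace_iff_contDiffAt.1
    (ContMDiffAt.mpullback_vectorField_preimage (I := 𝓘(ℝ, E6)) (I' := 𝓡 6) (n := ∞) hX
    (contMDiffAt_extChartAt_symm' hu) (isInvertible_mfderiv_extChartAt_symm hu) (by simp))

theorem differentiableAt_coordOfField (hu : u ∈ (extChartAt (𝓡 6) x₀).target) {X : VField M}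
    (hX : X.DiffAt ((extChartAt (𝓡 6) x₀).symm u)) :
    DifferentiableAt ℝ (coordOfField x₀ X) u := by
  have := MDifferentiableAt.mpullback_vectorField (I := 𝓘(ℝ, E6)) (I' := 𝓡 6) (n := ∞) hX
    (contMDiffAt_extChartAt_symm' hu) (isInvertible_mfderiv_extChartAt_symm hu) ENat.LEInfty.out
  exact MDifferentiableAt.differentiableAt
    ((contMDiff_snd_tangentBundle_modelSpace E6 𝓘(ℝ, E6)).contMDiffAt.mdifferentiableAt one_ne_zero
    |>.comp u this)

theorem diffAt_fieldOfCoord (hu : u ∈ (extChartAt (𝓡 6) x₀).target) {ξ : E6 → E6}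
    (hξ : ContDiffAt ℝ ∞ ξ u) : (fieldOfCoord x₀ ξ).DiffAt ((extChartAt (𝓡 6) x₀).symm u) :=
  (smoothAt_fieldOfCoord hu hξ).diffAt

theorem lieDerivFun_eq_fderiv (hu : u ∈ (extChartAt (𝓡 6) x₀).target) (X : VField M) {f : M → ℝ}
    (hf : MDifferentiableAt (𝓡 6) 𝓘(ℝ, ℝ) f ((extChartAt (𝓡 6) x₀).symm u)) :
    lieDerivFun X f ((extChartAt (𝓡 6) x₀).symm u) =
      fderiv ℝ (fun v ↦ f ((extChartAt (𝓡 6) x₀).symm v)) u (coordOfField x₀ X u) := by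
  have h1 := mvfderiv_comp_apply (I := 𝓡 6) (I' := 𝓘(ℝ, E6)) (f := (extChartAt (𝓡 6) x₀).symm) u hf
    ((contMDiffAt_extChartAt_symm' hu).mdifferentiableAt (by simp)) (coordOfField x₀ X u)
  have h2 : mfderiv 𝓘(ℝ, E6) (𝓡 6) (extChartAt (𝓡 6) x₀).symm u (coordOfField x₀ X u) =
      X ((extChartAt (𝓡 6) x₀).symm u) := chartFrame_coordOfField hu X
  rw [h2] at h1
  rw [lieDerivFun, ← h1, mvfderiv, mfderiv_eq_fderiv]
  rfl

theorem coordOfField_mlieBracket (hu : u ∈ (extChartAt (𝓡 6) x₀).target) {X Y : VField M}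
    (hX : X.DiffAt ((extChartAt (𝓡 6) x₀).symm u)) (hY : Y.DiffAt ((extChartAt (𝓡 6) x₀).symm u)) :
    coordOfField x₀ (VectorField.mlieBracket (𝓡 6) X Y) u =
      fderiv ℝ (coordOfField x₀ Y) u (coordOfField x₀ X u)
        - fderiv ℝ (coordOfField x₀ X) u (coordOfField x₀ Y u) := by
  have : IsManifold (𝓡 6) (minSmoothness ℝ 2) M := .of_le (n := ∞) (by
    rw [minSmoothness_of_isRCLikeNormedField]; exact ENat.LEInfty.out)
  have h := VectorField.mpullback_mlieBracket (I := 𝓘(ℝ, E6)) (I' := 𝓡 6) (n := ∞) hX hY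
    (contMDiffAt_extChartAt_symm' hu) (by
      rw [minSmoothness_of_isRCLikeNormedField]; exact ENat.LEInfty.out)
  refine h.trans ((congrFun VectorField.mlieBracketWithin_univ.symm u).trans ?_)
  refine (congrFun VectorField.mlieBracketWithin_eq_lieBracketWithin u).trans ?_
  change VectorField.lieBracketWithin ℝ (coordOfField x₀ X) (coordOfField x₀ Y) Set.univ u = _
  rw [VectorField.lieBracketWithin_univ, VectorField.lieBracket_eq]

omit [IsManifold (𝓡 6) ∞ M] in
theorem chartBilin_apply (Ω : BilinField M) (v w : E6) :
    chartBilin x₀ Ω u v w =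
      Ω ((extChartAt (𝓡 6) x₀).symm u) (chartFrame x₀ u v) (chartFrame x₀ u w) := rfl

omit [IsManifold (𝓡 6) ∞ M] in
theorem chartEnd_apply (J : EndField M) (v : E6) :
    chartEnd x₀ J u v =
      chartCoframe x₀ u (J ((extChartAt (𝓡 6) x₀).symm u) (chartFrame x₀ u v)) := rfl

theorem chartFrame_chartEnd (hu : u ∈ (extChartAt (𝓡 6) x₀).target) (J : EndField M) (v : E6) :
    chartFrame x₀ u (chartEnd x₀ J u v) =
      J ((extChartAt (𝓡 6) x₀).symm u) (chartFrame x₀ u v) := by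
  rw [chartEnd_apply, chartFrame_chartCoframe hu]

theorem eventually_chartBilin_eq (hu : u ∈ (extChartAt (𝓡 6) x₀).target) (Ω : BilinField M)
    (v w : E6) : (fun u ↦ chartBilin x₀ Ω u v w) =ᶠ[𝓝 u] fun u ↦
      Ω ((extChartAt (𝓡 6) x₀).symm u) (fieldOfCoord x₀ (fun _ ↦ v) ((extChartAt (𝓡 6) x₀).symm u))
        (fieldOfCoord x₀ (fun _ ↦ w) ((extChartAt (𝓡 6) x₀).symm u)) := by
  filter_upwards [(isOpen_extChartAt_target x₀).mem_nhds hu] with u hu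
  rw [chartBilin_apply, fieldOfCoord_apply hu, fieldOfCoord_apply hu]

theorem contDiffAt_chartBilin (hu : u ∈ (extChartAt (𝓡 6) x₀).target) {Ω : BilinField M}
    (hΩ : BilinField.SmoothAt Ω ((extChartAt (𝓡 6) x₀).symm u)) :
    ContDiffAt ℝ ∞ (chartBilin x₀ Ω) u := by
  refine contDiffAt_clm_of_apply fun v ↦ contDiffAt_clm_of_apply fun w ↦ ?_
  refine ContDiffAt.congr_of_eventuallyEq ?_ (eventually_chartBilin_eq hu Ω v w)
  rw [← contMDiffAt_iff_contDiffAt]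
  exact ContMDiffAt.comp u (hΩ.apply (smoothAt_fieldOfCoord hu contDiffAt_const)
    (smoothAt_fieldOfCoord hu contDiffAt_const)) (contMDiffAt_extChartAt_symm' hu)

theorem contDiffAt_chartEnd (hu : u ∈ (extChartAt (𝓡 6) x₀).target) {J : EndField M}
    (hJ : EndField.SmoothAt J ((extChartAt (𝓡 6) x₀).symm u)) :
    ContDiffAt ℝ ∞ (chartEnd x₀ J) u := by
  refine contDiffAt_clm_of_apply fun v ↦ ?_
  refine (contDiffAt_coordOfField hu
    (hJ.apply (smoothAt_fieldOfCoord hu (contDiffAt_const (c := v))))).congr_of_eventuallyEq ?_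
  filter_upwards [(isOpen_extChartAt_target x₀).mem_nhds hu] with u hu
  rw [coordOfField_apply hu, fieldOfCoord_apply hu, chartEnd_apply]

/-- Derivative of the components of bilinear form in the coordinate frame. -/
theorem lieDerivFun_chartBilin (hu : u ∈ (extChartAt (𝓡 6) x₀).target) {Ω : BilinField M}
    (hΩ : BilinField.SmoothAt Ω ((extChartAt (𝓡 6) x₀).symm u)) (v w z : E6) :
    lieDerivFun (fieldOfCoord x₀ fun _ ↦ v)
      (fun y ↦ Ω y (fieldOfCoord x₀ (fun _ ↦ w) y) (fieldOfCoord x₀ (fun _ ↦ z) y))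
      ((extChartAt (𝓡 6) x₀).symm u) = fderiv ℝ (chartBilin x₀ Ω) u v w z := by
  have h0 := hΩ.apply (smoothAt_fieldOfCoord hu (contDiffAt_const (c := w)))
    (smoothAt_fieldOfCoord hu (contDiffAt_const (c := z)))
  rw [lieDerivFun_eq_fderiv hu _ (h0.mdifferentiableAt (by simp)), coordOfField_fieldOfCoord hu,
    ← (eventually_chartBilin_eq hu Ω w z).fderiv_eq]
  have h1 := ((contDiffAt_chartBilin hu hΩ).differentiableAt (by simp)).hasFDerivAt
  rw [((h1.clm_apply (hasFDerivAt_const w u)).clm_apply (hasFDerivAt_const z u)).fderiv]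
  simp

theorem mlieBracket_fieldOfCoord_const (hu : u ∈ (extChartAt (𝓡 6) x₀).target) (v w : E6) :
    VectorField.mlieBracket (𝓡 6) (fieldOfCoord x₀ fun _ ↦ v) (fieldOfCoord x₀ fun _ ↦ w)
      ((extChartAt (𝓡 6) x₀).symm u) = 0 := by
  have hc (v : E6) : coordOfField x₀ (fieldOfCoord x₀ fun _ ↦ v) =ᶠ[𝓝 u] fun _ ↦ v := by
    filter_upwards [(isOpen_extChartAt_target x₀).mem_nhds hu] with u hu
    rw [coordOfField_fieldOfCoord hu]
  rw [← chartFrame_coordOfField hu (VectorField.mlieBracket (𝓡 6) _ _), coordOfField_mlieBracket hu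
    (diffAt_fieldOfCoord hu contDiffAt_const) (diffAt_fieldOfCoord hu contDiffAt_const),
    (hc v).fderiv_eq, (hc w).fderiv_eq]
  simp only [fderiv_fun_const, Pi.zero_apply, zero_apply, sub_self]
  exact map_zero (chartFrame x₀ u)

/-- The components of the Nijenhuis tensor in a chart. The derivatives of the components of `X` and
`Y` cancel by `J² = -1`. -/
theorem coordOfField_nijenhuis (hu : u ∈ (extChartAt (𝓡 6) x₀).target) {J : EndField M}
    (hJ : EndField.SmoothAt J ((extChartAt (𝓡 6) x₀).symm u))
    (sq : ∀ (x : M) (v : TangentSpace (𝓡 6) x), J x (J x v) = -v) {X Y : VField M}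
    (hX : X.DiffAt ((extChartAt (𝓡 6) x₀).symm u)) (hY : Y.DiffAt ((extChartAt (𝓡 6) x₀).symm u)) :
    coordOfField x₀ (nijenhuis J X Y) u =
      nijenhuisChart (chartEnd x₀ J) u (coordOfField x₀ X u) (coordOfField x₀ Y u) := by
  have hJX := hJ.apply_diffAt hX
  have hJY := hJ.apply_diffAt hY
  have hc (X : VField M) : coordOfField x₀ (fun y ↦ J y (X y)) =ᶠ[𝓝 u]
      fun u ↦ chartEnd x₀ J u (coordOfField x₀ X u) := by
    filter_upwards [(isOpen_extChartAt_target x₀).mem_nhds hu] with u hu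
    rw [coordOfField_apply hu, chartEnd_apply, chartFrame_coordOfField hu]
  have hd {X : VField M} (hX : X.DiffAt ((extChartAt (𝓡 6) x₀).symm u)) (w : E6) :
      fderiv ℝ (coordOfField x₀ (fun y ↦ J y (X y))) u w =
      fderiv ℝ (chartEnd x₀ J) u w (coordOfField x₀ X u)
        + chartEnd x₀ J u (fderiv ℝ (coordOfField x₀ X) u w) := by
    rw [(hc X).fderiv_eq]
    have h1 := ((contDiffAt_chartEnd hu hJ).differentiableAt (by simp)).hasFDerivAt
    rw [(h1.clm_apply (differentiableAt_coordOfField hu hX).hasFDerivAt).fderiv]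
    simp [add_comm]
  have hsq (v : E6) : chartEnd x₀ J u (chartEnd x₀ J u v) = -v := by
    rw [chartEnd_apply, chartFrame_chartEnd hu, sq, map_neg, chartCoframe_chartFrame hu]
  have hJc (V : TangentSpace (𝓡 6) ((extChartAt (𝓡 6) x₀).symm u)) :
      chartCoframe x₀ u (J _ V) = chartEnd x₀ J u (chartCoframe x₀ u V) := by
    rw [chartEnd_apply, chartFrame_chartCoframe hu]
  have b1 := coordOfField_mlieBracket hu hJX hJY
  have b2 := coordOfField_mlieBracket hu hJX hY
  have b3 := coordOfField_mlieBracket hu hX hJY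
  have b4 := coordOfField_mlieBracket hu hX hY
  rw [coordOfField_apply hu] at b1 b2 b3 b4
  rw [coordOfField_apply hu, nijenhuis, map_sub, map_sub, map_sub, hJc, hJc, b1, b2, b3, b4,
    hd hX, hd hX, hd hY, hd hY, (hc X).self_of_nhds, (hc Y).self_of_nhds, nijenhuisChart]
  simp only [map_add, map_sub, hsq]
  abel

end Chart

/-! ### Christoffel symbols -/

section Christoffel

set_option maxSynthPendingDepth 3

variable {E : Type*} [NormedAddCommGroup E] [NormedSpace ℝ E] [FiniteDimensional ℝ E]

/-- A positive definite bilinear form identifies the space with its dual. -/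
theorem exists_continuousLinearEquiv_of_pos {H : E →L[ℝ] E →L[ℝ] ℝ}
    (pos : ∀ x, x ≠ 0 → 0 < H x x) : ∃ e : E ≃L[ℝ] (E →L[ℝ] ℝ), (e : E →L[ℝ] E →L[ℝ] ℝ) = H := by
  have hinj : Function.Injective H.toLinearMap := by
    rw [← LinearMap.ker_eq_bot, LinearMap.ker_eq_bot']
    intro x hx
    by_contra hne
    exact (pos x hne).ne' (by simpa using DFunLike.congr_fun hx x)
  have hfin : Module.finrank ℝ E = Module.finrank ℝ (E →L[ℝ] ℝ) := by
    rw [← (LinearMap.toContinuousLinearMap : (E →ₗ[ℝ] ℝ) ≃ₗ[ℝ] (E →L[ℝ] ℝ)).finrank_eq]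
    exact Subspace.dual_finrank_eq.symm
  refine ⟨(LinearEquiv.ofInjectiveOfFinrankEq H.toLinearMap hinj hfin).toContinuousLinearEquiv, ?_⟩
  ext x y
  rfl

theorem ContDiffAt.inverse_of_pos {H : E → E →L[ℝ] E →L[ℝ] ℝ} {u : E} {n : ℕ∞ω}
    (hH : ContDiffAt ℝ n H u) (pos : ∀ x, x ≠ 0 → 0 < H u x x) :
    ContDiffAt ℝ n (fun v ↦ (H v).inverse) u := by
  obtain ⟨e, he⟩ := exists_continuousLinearEquiv_of_pos pos
  have h1 := contDiffAt_map_inverse (𝕜 := ℝ) (n := n) e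
  rw [he] at h1
  exact h1.comp u hH

theorem apply_inverse_of_pos {H : E →L[ℝ] E →L[ℝ] ℝ} (pos : ∀ x, x ≠ 0 → 0 < H x x)
    (α : E →L[ℝ] ℝ) : H (H.inverse α) = α := by
  obtain ⟨e, rfl⟩ := exists_continuousLinearEquiv_of_pos pos
  simp

/-- The Christoffel symbols of the first kind, as a linear function of the derivative of the
metric. -/
def christoffelLower : (E →L[ℝ] E →L[ℝ] E →L[ℝ] ℝ) →L[ℝ] (E →L[ℝ] E →L[ℝ] E →L[ℝ] ℝ) :=
  LinearMap.toContinuousLinearMap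
    { toFun T := (1 / 2 : ℝ) • (T + T.flip - ((ContinuousLinearMap.flipₗᵢ ℝ E E ℝ :
        (E →L[ℝ] E →L[ℝ] ℝ) →L[ℝ] (E →L[ℝ] E →L[ℝ] ℝ)).comp T.flip))
      map_add' S T := by ext; simp; ring
      map_smul' c T := by ext; simp; ring }

theorem christoffelLower_apply (T : E →L[ℝ] E →L[ℝ] E →L[ℝ] ℝ) (x y z : E) :
    christoffelLower T x y z = (1 / 2) * (T x y z + T y x z - T z x y) := by
  simp [christoffelLower]

/-- The Christoffel symbols of the metric `H`. -/
def christoffel (H : E → E →L[ℝ] E →L[ℝ] ℝ) (u : E) : E →L[ℝ] E →L[ℝ] E :=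
  (ContinuousLinearMap.compL ℝ E (E →L[ℝ] ℝ) E (H u).inverse).comp (christoffelLower (fderiv ℝ H u))

theorem apply_christoffel {H : E → E →L[ℝ] E →L[ℝ] ℝ} {u : E} (pos : ∀ x, x ≠ 0 → 0 < H u x x)
    (x y z : E) : H u (christoffel H u x y) z =
      (1 / 2) * (fderiv ℝ H u x y z + fderiv ℝ H u y x z - fderiv ℝ H u z x y) := by
  have := apply_inverse_of_pos pos (christoffelLower (fderiv ℝ H u) x y)
  rw [← christoffelLower_apply, ← this]
  rfl

theorem ContDiffAt.christoffel {H : E → E →L[ℝ] E →L[ℝ] ℝ} {u : E} (hH : ContDiffAt ℝ ∞ H u)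
    (pos : ∀ x, x ≠ 0 → 0 < H u x x) : ContDiffAt ℝ ∞ (christoffel H) u := by
  have h1 : ContDiffAt ℝ ∞ (fderiv ℝ H) u := hH.fderiv_right (by simp)
  exact ((ContinuousLinearMap.contDiff _).contDiffAt.comp u (hH.inverse_of_pos pos)).clm_comp
    ((ContinuousLinearMap.contDiff _).contDiffAt.comp u h1)

omit [FiniteDimensional ℝ E] in
theorem eq_of_forall_apply_eq {H : E →L[ℝ] E →L[ℝ] ℝ} (pos : ∀ x, x ≠ 0 → 0 < H x x) {x y : E}
    (h : ∀ z, H x z = H y z) : x = y := by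
  by_contra hne
  refine (pos _ (sub_ne_zero.2 hne)).ne' ?_
  rw [map_sub H, sub_apply, h, sub_self]

/-- The Christoffel symbols are determined by symmetry and compatibility with the metric. -/
theorem christoffel_unique {H : E → E →L[ℝ] E →L[ℝ] ℝ} {u : E} (symm : ∀ x y, H u x y = H u y x)
    (pos : ∀ x, x ≠ 0 → 0 < H u x x) {G : E → E → E} (hG : ∀ x y, G x y = G y x)
    (metric : ∀ w x y, fderiv ℝ H u w x y = H u (G w x) y + H u x (G w y)) (x y : E) :
    G x y = christoffel H u x y := by
  refine eq_of_forall_apply_eq pos fun z ↦ ?_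
  rw [apply_christoffel pos, metric, metric, metric, hG y x, hG z x, hG z y, symm y (G x z),
    symm x (G y z)]
  ring

end Christoffel

/-! ### Nearly Kähler manifolds in a chart -/

section NearlyKahler

variable {M : Type*} [TopologicalSpace M] [ChartedSpace E6 M] [IsManifold (𝓡 6) ∞ M]
  {h : RMetric M} {J : EndField M}
  {D : CovariantDerivative (𝓡 6) E6 (fun x : M ↦ TangentSpace (𝓡 6) x)}

theorem IsLeviCivita.lieDerivFun_inner (hD : IsLeviCivita h D) {x : M} (X : VField M)
    {Y Z : VField M} (hY : Y.DiffAt x) (hZ : Z.DiffAt x) :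
    lieDerivFun X (fun y ↦ h.inner y (Y y) (Z y)) x =
      h.inner x (D Y x (X x)) (Z x) + h.inner x (Y x) (D Z x (X x)) := by
  let _ : RiemannianBundle (fun x : M ↦ TangentSpace (𝓡 6) x) := ⟨h.toRiemannianMetric⟩
  exact hD.1.mvfderiv_inner_eq X hY hZ

theorem IsLeviCivita.sub_eq_mlieBracket (hD : IsLeviCivita h D) {x : M} {X Y : VField M}
    (hX : X.DiffAt x) (hY : Y.DiffAt x) :
    D Y x (X x) - D X x (Y x) = VectorField.mlieBracket (𝓡 6) X Y x := by
  have := (CovariantDerivative.torsion_eq_zero_iff D).1 hD.2 hX hY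
  exact this

theorem IsAlmostHermitian.inner_skew (hJ : IsAlmostHermitian h J) (x : M)
    (v w : TangentSpace (𝓡 6) x) : h.inner x (J x v) w = -h.inner x v (J x w) := by
  rw [← hJ.invariant x v (J x w), hJ.almostComplex.sq, map_neg, neg_neg]

theorem IsAlmostHermitian.extDerivTwo_fundForm_self (hJ : IsAlmostHermitian h J) (X Z : VField M)
    (x : M) : extDerivTwo (fundForm h J) X X Z x = 0 := by
  have hself : (fun y ↦ fundForm h J y (X y) (X y)) = fun _ ↦ 0 := by
    funext y
    have h1 := hJ.inner_skew y (X y) (X y)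
    have h2 := h.symm y (J y (X y)) (X y)
    change h.inner y (J y (X y)) (X y) = 0
    linarith
  have h0 : lieDerivFun Z (fun _ : M ↦ (0 : ℝ)) x = 0 := by
    rw [lieDerivFun, mvfderiv_const]
    rfl
  rw [extDerivTwo, hself, VectorField.mlieBracket_self, h0]
  simp

section Coordinates

variable {x₀ : M} {u : E6}

theorem chartBilin_inner_symm (x y : E6) :
    chartBilin x₀ h.inner u x y = chartBilin x₀ h.inner u y x :=
  h.symm _ _ _

theorem chartBilin_pos (hu : u ∈ (extChartAt (𝓡 6) x₀).target) {Ω : BilinField M}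
    (pos : ∀ v : TangentSpace (𝓡 6) ((extChartAt (𝓡 6) x₀).symm u), v ≠ 0 →
      0 < Ω ((extChartAt (𝓡 6) x₀).symm u) v v) (x : E6) (hx : x ≠ 0) :
    0 < chartBilin x₀ Ω u x x :=
  pos _ fun h0 ↦ hx ((chartCoframe_chartFrame hu x).symm.trans
    ((congrArg (chartCoframe x₀ u) h0).trans (map_zero (chartCoframe x₀ u))))

theorem contDiffAt_chartBilin_inner (hu : u ∈ (extChartAt (𝓡 6) x₀).target) :
    ContDiffAt ℝ ∞ (chartBilin x₀ h.inner) u :=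
  contDiffAt_chartBilin hu (h.contMDiff _)

theorem fderiv_chartBilin_inner_symm (hu : u ∈ (extChartAt (𝓡 6) x₀).target) (w x y : E6) :
    fderiv ℝ (chartBilin x₀ h.inner) u w x y = fderiv ℝ (chartBilin x₀ h.inner) u w y x := by
  have h1 := ((contDiffAt_chartBilin_inner (h := h) hu).differentiableAt (by simp)).hasFDerivAt
  simpa using ((h1.clm_apply (hasFDerivAt_const x u)).clm_apply
    (hasFDerivAt_const y u)).apply_eq_of_eqOn ((h1.clm_apply (hasFDerivAt_const y u)).clm_apply
    (hasFDerivAt_const x u)) isOpen_univ (Set.mem_univ u)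
    (fun v _ ↦ chartBilin_inner_symm x y) w

/-- The components of the Levi-Civita connection in the coordinate frame are the Christoffel
symbols. -/
theorem IsLeviCivita.apply_fieldOfCoord (hD : IsLeviCivita h D)
    (hu : u ∈ (extChartAt (𝓡 6) x₀).target) (x y : E6) :
    D (fieldOfCoord x₀ fun _ ↦ y) ((extChartAt (𝓡 6) x₀).symm u) (chartFrame x₀ u x) =
      chartFrame x₀ u (christoffel (chartBilin x₀ h.inner) u x y) := by
  have hd (v : E6) : (fieldOfCoord x₀ fun _ ↦ v).DiffAt ((extChartAt (𝓡 6) x₀).symm u) :=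
    diffAt_fieldOfCoord hu contDiffAt_const
  rw [← christoffel_unique (H := chartBilin x₀ h.inner) (fun x y ↦ chartBilin_inner_symm x y)
    (chartBilin_pos hu (h.pos _))
    (G := fun x y ↦ chartCoframe x₀ u (D (fieldOfCoord x₀ fun _ ↦ y)
      ((extChartAt (𝓡 6) x₀).symm u) (chartFrame x₀ u x))) ?_ ?_, chartFrame_chartCoframe hu]
  · intro x y
    have := hD.sub_eq_mlieBracket (hd x) (hd y)
    rw [mlieBracket_fieldOfCoord_const hu, fieldOfCoord_apply hu, fieldOfCoord_apply hu,
      sub_eq_zero] at this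
    exact congrArg _ this
  · intro w x y
    have := hD.lieDerivFun_inner (fieldOfCoord x₀ fun _ ↦ w) (hd x) (hd y)
    rw [lieDerivFun_chartBilin hu (h.contMDiff _), fieldOfCoord_apply hu, fieldOfCoord_apply hu,
      fieldOfCoord_apply hu] at this
    rw [this, chartBilin_apply, chartBilin_apply, chartFrame_chartCoframe hu,
      chartFrame_chartCoframe hu]

theorem lieDerivFun_fundForm (hu : u ∈ (extChartAt (𝓡 6) x₀).target)
    (hJ : EndField.SmoothAt J ((extChartAt (𝓡 6) x₀).symm u)) (x y z : E6) :
    lieDerivFun (fieldOfCoord x₀ fun _ ↦ x)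
      (fun v ↦ fundForm h J v (fieldOfCoord x₀ (fun _ ↦ y) v) (fieldOfCoord x₀ (fun _ ↦ z) v))
      ((extChartAt (𝓡 6) x₀).symm u) =
    fderiv ℝ (chartBilin x₀ h.inner) u x (chartEnd x₀ J u y) z +
      chartBilin x₀ h.inner u (fderiv ℝ (chartEnd x₀ J) u x y) z := by
  have hs (v : E6) : VField.SmoothAt (fieldOfCoord x₀ fun _ ↦ v) ((extChartAt (𝓡 6) x₀).symm u) :=
    smoothAt_fieldOfCoord hu contDiffAt_const
  have h0 := BilinField.SmoothAt.apply (Ω := h.inner) (h.contMDiff _) (hJ.apply (hs y)) (hs z)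
  have he : (fun v ↦ chartBilin x₀ h.inner v (chartEnd x₀ J v y) z) =ᶠ[𝓝 u]
      fun v ↦ fundForm h J ((extChartAt (𝓡 6) x₀).symm v)
        (fieldOfCoord x₀ (fun _ ↦ y) ((extChartAt (𝓡 6) x₀).symm v))
        (fieldOfCoord x₀ (fun _ ↦ z) ((extChartAt (𝓡 6) x₀).symm v)) := by
    filter_upwards [(isOpen_extChartAt_target x₀).mem_nhds hu] with v hv
    rw [fieldOfCoord_apply hv, fieldOfCoord_apply hv, chartBilin_apply, chartFrame_chartEnd hv]
    rfl
  have h1 := ((contDiffAt_chartBilin_inner (h := h) hu).differentiableAt (by simp)).hasFDerivAt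
  have h2 := ((contDiffAt_chartEnd hu hJ).differentiableAt (by simp)).hasFDerivAt
  refine (lieDerivFun_eq_fderiv hu _ (h0.mdifferentiableAt (by simp))).trans ?_
  rw [coordOfField_fieldOfCoord hu]
  refine (DFunLike.congr_fun he.fderiv_eq.symm x).trans ?_
  rw [((h1.clm_apply (h2.clm_apply (hasFDerivAt_const y u))).clm_apply
    (hasFDerivAt_const z u)).fderiv]
  simp [add_comm]

end Coordinates

/-- The condition `D F = (1/3) dF` gives `(D_X J) X = 0`, because the right-hand side is alternating
in its arguments. -/
theorem IsNearlyKahler.isNearlyKahlerChart (hNK : IsNearlyKahler h J) (x₀ : M) :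
    IsNearlyKahlerChart (extChartAt (𝓡 6) x₀).target (chartBilin x₀ h.inner) (chartEnd x₀ J)
      (christoffel (chartBilin x₀ h.inner)) := by
  obtain ⟨hJ, D, hD, hDF⟩ := hNK
  have smoothJ (x : M) : EndField.SmoothAt J x := hJ.almostComplex.smooth x
  have pos {u : E6} (hu : u ∈ (extChartAt (𝓡 6) x₀).target) (x : E6) (hx : x ≠ 0) :
      0 < chartBilin x₀ h.inner u x x := chartBilin_pos hu (h.pos _) x hx
  have metric (u : E6) (hu : u ∈ (extChartAt (𝓡 6) x₀).target) (w x y : E6) :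
      fderiv ℝ (chartBilin x₀ h.inner) u w x y =
        chartBilin x₀ h.inner u (christoffel (chartBilin x₀ h.inner) u w x) y +
          chartBilin x₀ h.inner u x (christoffel (chartBilin x₀ h.inner) u w y) := by
    rw [chartBilin_inner_symm x, apply_christoffel (pos hu), apply_christoffel (pos hu),
      fderiv_chartBilin_inner_symm hu x w y, fderiv_chartBilin_inner_symm hu w y x]
    ring
  refine
    { isOpen := isOpen_extChartAt_target x₀
      contDiffAt_H := fun u hu ↦ contDiffAt_chartBilin_inner hu
      contDiffAt_J := fun u hu ↦ contDiffAt_chartEnd hu (smoothJ _)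
      contDiffAt_Γ := fun u hu ↦ (contDiffAt_chartBilin_inner hu).christoffel (pos hu)
      symm := fun u _ x y ↦ chartBilin_inner_symm x y
      pos := fun u hu ↦ pos hu
      sq := fun u hu x ↦ ?_
      skew := fun u hu x y ↦ ?_
      torsionFree := fun u hu x y ↦ ?_
      metric := metric
      nearlyKahler := fun u hu x ↦ ?_ }
  · rw [chartEnd_apply, chartFrame_chartEnd hu, hJ.almostComplex.sq, map_neg,
      chartCoframe_chartFrame hu]
  · simp only [chartBilin_apply, chartFrame_chartEnd hu, hJ.inner_skew]
  · refine eq_of_forall_apply_eq (pos hu) fun z ↦ ?_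
    rw [apply_christoffel (pos hu), apply_christoffel (pos hu),
      fderiv_chartBilin_inner_symm hu z x y]
    ring
  · have hd (v : E6) : (fieldOfCoord x₀ fun _ ↦ v).DiffAt ((extChartAt (𝓡 6) x₀).symm u) :=
      diffAt_fieldOfCoord hu contDiffAt_const
    refine eq_of_forall_apply_eq (pos hu) fun z ↦ ?_
    have key := hDF _ _ _ _ (hd x) (hd x) (hd z)
    rw [hJ.extDerivTwo_fundForm_self, mul_zero, covDerivBilin, lieDerivFun_fundForm hu (smoothJ _),
      fieldOfCoord_apply hu, fieldOfCoord_apply hu, hD.apply_fieldOfCoord hu,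
      hD.apply_fieldOfCoord hu, metric u hu] at key
    have e1 (v w : E6) : fundForm h J ((extChartAt (𝓡 6) x₀).symm u) (chartFrame x₀ u v)
        (chartFrame x₀ u w) = chartBilin x₀ h.inner u (chartEnd x₀ J u v) w := by
      rw [chartBilin_apply, chartFrame_chartEnd hu]
      rfl
    rw [e1, e1] at key
    rw [covDerivEnd_apply]
    simp only [map_add, map_sub, add_apply, sub_apply, map_zero, zero_apply]
    linarith

end NearlyKahler

/-! ### Compatible symplectic forms and the Nijenhuis tensor -/

section Symplectic

variable {M : Type*} [TopologicalSpace M] [ChartedSpace E6 M] [IsManifold (𝓡 6) ∞ M]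
  {J : EndField M} {Ω : BilinField M} {U : Set M} {x₀ : M} {u : E6}

theorem IsSymplecticOn.smoothAt (hΩ : IsSymplecticOn Ω U) (hU : IsOpen U) {x : M} (hx : x ∈ U) :
    BilinField.SmoothAt Ω x :=
  hΩ.smooth.contMDiffAt (hU.mem_nhds hx)

theorem IsSymplecticOn.skew (hΩ : IsSymplecticOn Ω U) {x : M} (hx : x ∈ U)
    (v w : TangentSpace (𝓡 6) x) : Ω x v w = -Ω x w v := by
  have h := hΩ.alternating x hx (v + w)
  rw [map_add, map_add, add_apply, add_apply, hΩ.alternating x hx, hΩ.alternating x hx] at h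
  linarith

theorem IsSymplecticOn.fderiv_chartBilin (hΩ : IsSymplecticOn Ω U) (hU : IsOpen U)
    (hu : u ∈ (extChartAt (𝓡 6) x₀).target) (huU : (extChartAt (𝓡 6) x₀).symm u ∈ U) (x y z : E6) :
    fderiv ℝ (chartBilin x₀ Ω) u x y z - fderiv ℝ (chartBilin x₀ Ω) u y x z
      + fderiv ℝ (chartBilin x₀ Ω) u z x y = 0 := by
  have hd (v : E6) : (fieldOfCoord x₀ fun _ ↦ v).DiffAt ((extChartAt (𝓡 6) x₀).symm u) :=
    diffAt_fieldOfCoord hu contDiffAt_const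
  have hs := hΩ.smoothAt hU huU
  have := hΩ.closed _ huU _ _ _ (hd x) (hd y) (hd z)
  rw [extDerivTwo, lieDerivFun_chartBilin hu hs, lieDerivFun_chartBilin hu hs,
    lieDerivFun_chartBilin hu hs, mlieBracket_fieldOfCoord_const hu,
    mlieBracket_fieldOfCoord_const hu, mlieBracket_fieldOfCoord_const hu] at this
  have h0 (v : TangentSpace (𝓡 6) ((extChartAt (𝓡 6) x₀).symm u)) :
      Ω ((extChartAt (𝓡 6) x₀).symm u) 0 v = 0 :=
    DFunLike.congr_fun (map_zero (Ω ((extChartAt (𝓡 6) x₀).symm u))) v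
  linarith [h0 (fieldOfCoord x₀ (fun _ ↦ x) ((extChartAt (𝓡 6) x₀).symm u)),
    h0 (fieldOfCoord x₀ (fun _ ↦ y) ((extChartAt (𝓡 6) x₀).symm u)),
    h0 (fieldOfCoord x₀ (fun _ ↦ z) ((extChartAt (𝓡 6) x₀).symm u))]

theorem IsSymplecticOn.sum_chartBilin_nijenhuisChart (hΩ : IsSymplecticOn Ω U)
    (hJΩ : IsCompatibleOn J Ω U) (hU : IsOpen U)
    (sq : ∀ (x : M) (v : TangentSpace (𝓡 6) x), J x (J x v) = -v)
    (hu : u ∈ (extChartAt (𝓡 6) x₀).target) (huU : (extChartAt (𝓡 6) x₀).symm u ∈ U)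
    (hJ : DifferentiableAt ℝ (chartEnd x₀ J) u) (x y z : E6) :
    chartBilin x₀ Ω u (nijenhuisChart (chartEnd x₀ J) u x y) z
      + chartBilin x₀ Ω u (nijenhuisChart (chartEnd x₀ J) u y z) x
      + chartBilin x₀ Ω u (nijenhuisChart (chartEnd x₀ J) u z x) y = 0 := by
  refine sum_apply_nijenhuisChart_eq_zero
    ((continuousOn_extChartAt_symm x₀).isOpen_inter_preimage (isOpen_extChartAt_target x₀) hU)
    ⟨hu, huU⟩ hJ ((contDiffAt_chartBilin hu (hΩ.smoothAt hU huU)).differentiableAt (by simp))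
    ?_ ?_ ?_ (hΩ.fderiv_chartBilin hU hu huU) x y z
  · intro v hv x
    rw [chartEnd_apply, chartFrame_chartEnd hv.1, sq, map_neg, chartCoframe_chartFrame hv.1]
  · intro v hv x
    rw [chartBilin_apply, hΩ.alternating _ hv.2]
  · intro v hv x y
    rw [chartBilin_apply, chartBilin_apply, chartFrame_chartEnd hv.1, chartFrame_chartEnd hv.1,
      hJΩ.symm _ hv.2]

end Symplectic

/-! ### The obstruction on nearly Kähler manifolds -/

section Obstruction

set_option maxSynthPendingDepth 3

variable {M : Type*} [TopologicalSpace M] [ChartedSpace E6 M] [IsManifold (𝓡 6) ∞ M]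
  {h : RMetric M} {J : EndField M} {U : Set M}

/-- The Nijenhuis tensor of `J` vanishes at the point `x`. -/
def NijenhuisVanishesAt (J : EndField M) (x : M) : Prop :=
  ∀ X Y : VField M, X.DiffAt x → Y.DiffAt x → nijenhuis J X Y x = 0

theorem IsNearlyKahler.nijenhuisVanishesAt_iff (hNK : IsNearlyKahler h J) {x₀ : M} {u : E6}
    (hu : u ∈ (extChartAt (𝓡 6) x₀).target) :
    NijenhuisVanishesAt J ((extChartAt (𝓡 6) x₀).symm u) ↔
      covDerivEnd (chartEnd x₀ J) (christoffel (chartBilin x₀ h.inner)) u = 0 := by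
  have hJ := hNK.almostHermitian.almostComplex
  rw [← (hNK.isNearlyKahlerChart x₀).nijenhuisChart_eq_zero_iff hu]
  constructor
  · intro hN x y
    have hd (v : E6) : (fieldOfCoord x₀ fun _ ↦ v).DiffAt ((extChartAt (𝓡 6) x₀).symm u) :=
      diffAt_fieldOfCoord hu contDiffAt_const
    have := coordOfField_nijenhuis hu (hJ.smooth _) hJ.sq (hd x) (hd y)
    rw [coordOfField_fieldOfCoord hu, coordOfField_fieldOfCoord hu] at this
    rw [← this, coordOfField_apply hu, hN _ _ (hd x) (hd y), map_zero]
  · intro hN X Y hX hY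
    rw [← chartFrame_coordOfField hu (nijenhuis J X Y),
      coordOfField_nijenhuis hu (hJ.smooth _) hJ.sq hX hY, hN]
    exact map_zero (chartFrame x₀ u)

theorem IsNearlyKahler.nijenhuisVanishesAt_of_admitsCompatibleSymplecticOn
    (hNK : IsNearlyKahler h J) (hU : IsOpen U) (hΩ : AdmitsCompatibleSymplecticOn J U) {x : M}
    (hx : x ∈ U) : NijenhuisVanishesAt J x := by
  obtain ⟨Ω, hΩ, hJΩ⟩ := hΩ
  have hJ := hNK.almostHermitian.almostComplex
  have hu := mem_extChartAt_target (I := 𝓡 6) x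
  have e := extChartAt_to_inv (I := 𝓡 6) x
  have huU : (extChartAt (𝓡 6) x).symm (extChartAt (𝓡 6) x x) ∈ U := by rwa [e]
  have hch := hNK.isNearlyKahlerChart x
  rw [← e, hNK.nijenhuisVanishesAt_iff hu]
  refine torsion_eq_zero_of_compatible (Ω := chartBilin x Ω (extChartAt (𝓡 6) x x)) (by simp)
    (hch.symm _ hu) (hch.pos _ hu) (hch.sq _ hu) (hch.skew _ hu) (hch.covDerivEnd_swap hu)
    (hch.covDerivEnd_comp hu) (hch.covDerivEnd_skew hu) ?_ ?_ ?_
  · intro v w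
    exact hΩ.skew huU _ _
  · intro v hv
    rw [chartBilin_apply, chartFrame_chartEnd hu]
    exact hJΩ.pos _ huU _ fun h0 ↦ hv ((chartCoframe_chartFrame hu v).symm.trans
      ((congrArg (chartCoframe x _) h0).trans (map_zero (chartCoframe x _))))
  · intro v w z
    have := hΩ.sum_chartBilin_nijenhuisChart hJΩ hU hJ.sq hu huU
      ((hch.contDiffAt_J _ hu).differentiableAt (by simp)) v w z
    simp only [hch.nijenhuisChart_eq hu, map_smul, smul_apply, smul_eq_mul] at this
    linarith

theorem IsNearlyKahler.isOpen_setOf_nijenhuisVanishesAt (hNK : IsNearlyKahler h J) :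
    IsOpen {x | NijenhuisVanishesAt J x} := by
  refine isOpen_iff_mem_nhds.2 fun x hx ↦ ?_
  have hu := mem_extChartAt_target (I := 𝓡 6) x
  have e := extChartAt_to_inv (I := 𝓡 6) x
  have hx' : NijenhuisVanishesAt J x := hx
  rw [← e, hNK.nijenhuisVanishesAt_iff hu] at hx'
  have := (hNK.isNearlyKahlerChart x).eventually_covDerivEnd_eq_zero hu hx'
  filter_upwards [(continuousAt_extChartAt (I := 𝓡 6) x).eventually this,
    extChartAt_source_mem_nhds (I := 𝓡 6) x] with y hy hys
  have := (hNK.nijenhuisVanishesAt_iff ((extChartAt (𝓡 6) x).map_source hys)).2 hy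
  rwa [(extChartAt (𝓡 6) x).left_inv hys] at this

theorem IsNearlyKahler.isClosed_setOf_nijenhuisVanishesAt (hNK : IsNearlyKahler h J) :
    IsClosed {x | NijenhuisVanishesAt J x} := by
  refine isOpen_compl_iff.1 (isOpen_iff_mem_nhds.2 fun x hx ↦ ?_)
  have hu := mem_extChartAt_target (I := 𝓡 6) x
  have e := extChartAt_to_inv (I := 𝓡 6) x
  have hx' : ¬ NijenhuisVanishesAt J x := hx
  rw [← e, hNK.nijenhuisVanishesAt_iff hu] at hx'
  have hch := hNK.isNearlyKahlerChart x
  have := ((hch.contDiffAt_J _ hu).covDerivEnd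
    (hch.contDiffAt_Γ _ hu)).continuousAt.eventually_ne hx'
  filter_upwards [(continuousAt_extChartAt (I := 𝓡 6) x).eventually this,
    extChartAt_source_mem_nhds (I := 𝓡 6) x] with y hy hys hN
  refine hy ((hNK.nijenhuisVanishesAt_iff ((extChartAt (𝓡 6) x).map_source hys)).1 ?_)
  rwa [(extChartAt (𝓡 6) x).left_inv hys]

/-- On a connected nearly Kähler manifold the zeros of the Nijenhuis tensor form an open and closed
set, so it has none unless it vanishes identically. -/
theorem IsNearlyKahler.not_nijenhuisVanishesAt [ConnectedSpace M] (hNK : IsNearlyKahler h J)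
    (hJ : ¬ IsIntegrable J) (x : M) : ¬ NijenhuisVanishesAt J x := fun hx ↦ by
  have := IsClopen.eq_univ ⟨hNK.isClosed_setOf_nijenhuisVanishesAt,
    hNK.isOpen_setOf_nijenhuisVanishesAt⟩ ⟨x, hx⟩
  exact hJ fun y ↦ Set.eq_univ_iff_forall.1 this y

end Obstruction

/-! ### The cross product of `ℝ⁷` -/

section CrossProduct

open scoped RealInnerProductSpace

theorem cross7_swap (x y : E7) : cross7 x y = -cross7 y x := by
  ext k; simp [cross7]; ring

theorem inner_cross7_comm (x y z : E7) : ⟪cross7 x y, z⟫ = ⟪x, cross7 y z⟫ := by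
  simp only [cross7, PiLp.inner_apply, Fin.sum_univ_seven, RCLike.inner_apply, conj_trivial,
    Fin.isValue, Fin.reduceAdd, zero_add]
  ring

/-- The polarization of `x × (x × z) = ⟪x, z⟫ x - ⟪x, x⟫ z`. -/
theorem cross7_cross7_add (x y z : E7) :
    cross7 x (cross7 y z) + cross7 y (cross7 x z) =
      ⟪x, z⟫ • y + ⟪y, z⟫ • x - (2 * ⟪x, y⟫) • z := by
  ext k
  fin_cases k <;>
  · simp [cross7, PiLp.inner_apply, Fin.sum_univ_seven]
    ring

theorem cross7_cross7_self (x z : E7) : cross7 x (cross7 x z) = ⟪x, z⟫ • x - ⟪x, x⟫ • z := by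
  have := cross7_cross7_add x x z
  have h2 : (2 : ℝ) • cross7 x (cross7 x z) = (2 : ℝ) • (⟪x, z⟫ • x - ⟪x, x⟫ • z) := by
    rw [two_smul, this]; module
  exact smul_right_injective _ two_ne_zero h2

/-- The expression for the Nijenhuis tensor of `S⁶` at `p`, simplified for tangent vectors. -/
theorem nijenhuis_cross7 {p x y : E7} (hx : ⟪p, x⟫ = 0) (hy : ⟪p, y⟫ = 0) :
    cross7 (cross7 p x) y - cross7 (cross7 p y) x - (2 : ℝ) • cross7 p (cross7 x y) =
      (-4 : ℝ) • cross7 p (cross7 x y) := by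
  have h1 := cross7_cross7_add y p x
  have h2 := cross7_cross7_add x p y
  rw [hx, real_inner_comm p y, hy] at h1
  rw [hy, real_inner_comm p x, hx] at h2
  have h3 : cross7 p (cross7 y x) = -cross7 p (cross7 x y) := by
    rw [cross7_swap y x]; exact map_neg (cross7L p) _
  rw [h3] at h1
  rw [cross7_swap (cross7 p x) y, cross7_swap (cross7 p y) x]
  rw [← eq_sub_iff_add_eq] at h1 h2
  rw [h1, h2, real_inner_comm x y]
  module

/-- The cross product of `ℝ⁷` as a continuous bilinear map. -/
def cross7CLM : E7 →L[ℝ] E7 →L[ℝ] E7 :=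
  LinearMap.toContinuousLinearMap
    { toFun x := LinearMap.toContinuousLinearMap (cross7L x)
      map_add' x y := by ext z k; simp [cross7L, cross7]; ring
      map_smul' c x := by ext z k; simp [cross7L, cross7]; ring }

theorem cross7CLM_apply (x y : E7) : cross7CLM x y = cross7 x y := rfl

theorem exists_ne_zero_inner_eq_zero (a b c : E7) :
    ∃ y : E7, y ≠ 0 ∧ ⟪a, y⟫ = 0 ∧ ⟪b, y⟫ = 0 ∧ ⟪c, y⟫ = 0 := by
  have h := LinearMap.ker_ne_bot_of_finrank_lt
    (f := (innerₗ E7 a).prod ((innerₗ E7 b).prod (innerₗ E7 c))) (by simp)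
  obtain ⟨y, hy, hy0⟩ := Submodule.exists_mem_ne_zero_of_ne_bot h
  refine ⟨y, hy0, ?_⟩
  simpa using hy

end CrossProduct

/-! ### The almost complex structure of the six-sphere -/

section Sphere

set_option maxSynthPendingDepth 3

open scoped RealInnerProductSpace

theorem mvfderiv_coe_standardJ (p : S6) (v : TangentSpace (𝓡 6) p) :
    mvfderiv (𝓡 6) ((↑) : S6 → E7) p (standardJ p v) =
      cross7 p (mvfderiv (𝓡 6) ((↑) : S6 → E7) p v) :=
  congrArg Subtype.val (LinearEquiv.apply_symm_apply (tangentEquivS6 p)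
    (cross7Perp p (tangentEquivS6 p v)))

theorem inner_mvfderiv_coe (p : S6) (v : TangentSpace (𝓡 6) p) :
    ⟪(p : E7), mvfderiv (𝓡 6) ((↑) : S6 → E7) p v⟫ = 0 :=
  Submodule.mem_orthogonal_singleton_iff_inner_right.1 (tangentEquivS6 p v).2

theorem exists_mvfderiv_coe_eq (p : S6) {y : E7} (hy : ⟪(p : E7), y⟫ = 0) :
    ∃ v : TangentSpace (𝓡 6) p, mvfderiv (𝓡 6) ((↑) : S6 → E7) p v = y :=
  ⟨(tangentEquivS6 p).symm ⟨y, Submodule.mem_orthogonal_singleton_iff_inner_right.2 hy⟩,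
    congrArg Subtype.val (LinearEquiv.apply_symm_apply (tangentEquivS6 p) _)⟩

theorem standardJ_standardJ (p : S6) (v : TangentSpace (𝓡 6) p) :
    standardJ p (standardJ p v) = -v := by
  apply injective_mvfderiv_subtypeVal_sphere p
  have hp : ⟪(p : E7), (p : E7)⟫ = 1 := by simp
  change mvfderiv (𝓡 6) ((↑) : S6 → E7) p _ = mvfderiv (𝓡 6) ((↑) : S6 → E7) p _
  rw [mvfderiv_coe_standardJ, mvfderiv_coe_standardJ, cross7_cross7_self, inner_mvfderiv_coe, hp,
    map_neg]
  simp

variable {p₀ : S6} {u : E6}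

/-- The inverse of a chart of the sphere, as a parametrization with values in `ℝ⁷`. -/
def sphereParam (p₀ : S6) (u : E6) : E7 := ((extChartAt (𝓡 6) p₀).symm u : S6)

theorem contDiffAt_sphereParam (hu : u ∈ (extChartAt (𝓡 6) p₀).target) :
    ContDiffAt ℝ ∞ (sphereParam p₀) u :=
  contMDiffAt_iff_contDiffAt.1 ((contMDiff_coe_sphere (m := ∞) _).comp u
    (contMDiffAt_extChartAt_symm' hu))

theorem fderiv_sphereParam (hu : u ∈ (extChartAt (𝓡 6) p₀).target) (v : E6) :
    fderiv ℝ (sphereParam p₀) u v =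
      mvfderiv (𝓡 6) ((↑) : S6 → E7) ((extChartAt (𝓡 6) p₀).symm u) (chartFrame p₀ u v) := by
  have h0 : MDifferentiableAt (𝓡 6) 𝓘(ℝ, E7) ((↑) : S6 → E7) ((extChartAt (𝓡 6) p₀).symm u) :=
    (contMDiff_coe_sphere (m := ∞)).contMDiffAt.mdifferentiableAt (by simp)
  have h1 := mfderiv_comp_apply (I := 𝓘(ℝ, E6)) (I' := 𝓡 6) (I'' := 𝓘(ℝ, E7)) u h0 ((contMDiffAt_extChartAt_symm' hu).mdifferentiableAt (by simp)) v
  rw [mfderiv_eq_fderiv] at h1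
  exact h1

theorem inner_fderiv_sphereParam (hu : u ∈ (extChartAt (𝓡 6) p₀).target) (v : E6) :
    ⟪sphereParam p₀ u, fderiv ℝ (sphereParam p₀) u v⟫ = 0 := by
  rw [fderiv_sphereParam hu]
  exact inner_mvfderiv_coe _ _

theorem fderiv_sphereParam_injective (hu : u ∈ (extChartAt (𝓡 6) p₀).target) :
    Function.Injective (fderiv ℝ (sphereParam p₀) u) := fun v w h ↦ by
  rw [fderiv_sphereParam hu, fderiv_sphereParam hu] at h
  have := injective_mvfderiv_subtypeVal_sphere _ h
  rw [← chartCoframe_chartFrame hu v, ← chartCoframe_chartFrame hu w]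
  exact congrArg _ this

theorem exists_fderiv_sphereParam_eq (hu : u ∈ (extChartAt (𝓡 6) p₀).target) {y : E7}
    (hy : ⟪sphereParam p₀ u, y⟫ = 0) : ∃ v, fderiv ℝ (sphereParam p₀) u v = y := by
  obtain ⟨v, hv⟩ := exists_mvfderiv_coe_eq ((extChartAt (𝓡 6) p₀).symm u) hy
  refine ⟨chartCoframe p₀ u v, ?_⟩
  rw [fderiv_sphereParam hu, chartFrame_chartCoframe hu, hv]

theorem fderiv_sphereParam_chartEnd (hu : u ∈ (extChartAt (𝓡 6) p₀).target) (v : E6) :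
    fderiv ℝ (sphereParam p₀) u (chartEnd p₀ standardJ u v) =
      cross7CLM (sphereParam p₀ u) (fderiv ℝ (sphereParam p₀) u v) := by
  rw [fderiv_sphereParam hu, fderiv_sphereParam hu, chartFrame_chartEnd hu,
    mvfderiv_coe_standardJ]
  rfl

/-- With a left inverse `L` of the derivative `P u` of the parametrization at `u`, the components of
`J` near `u` are `(L ∘ P v)⁻¹ ∘ L ∘ (φ v × ·) ∘ P v`. -/
theorem differentiableAt_chartEnd_standardJ (hu : u ∈ (extChartAt (𝓡 6) p₀).target) :
    DifferentiableAt ℝ (chartEnd p₀ standardJ) u := by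
  obtain ⟨L₀, hL₀⟩ := LinearMap.exists_leftInverse_of_injective
    (fderiv ℝ (sphereParam p₀) u).toLinearMap
    (LinearMap.ker_eq_bot.2 (fderiv_sphereParam_injective hu))
  let L : E7 →L[ℝ] E6 := L₀.toContinuousLinearMap
  let A : E6 → E6 →L[ℝ] E6 := fun v ↦ L.comp (fderiv ℝ (sphereParam p₀) v)
  have hAu : A u = ContinuousLinearEquiv.refl ℝ E6 := by
    ext1 v
    exact DFunLike.congr_fun hL₀ v
  have h0 := contDiffAt_sphereParam hu
  have h1 : ContDiffAt ℝ ∞ (fderiv ℝ (sphereParam p₀)) u := h0.fderiv_right (by simp)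
  have hA : ContDiffAt ℝ ∞ A u := contDiffAt_const.clm_comp h1
  have hinv : ContDiffAt ℝ ∞ (fun v ↦ (A v).inverse) u := by
    have := contDiffAt_map_inverse (𝕜 := ℝ) (n := ∞) (ContinuousLinearEquiv.refl ℝ E6)
    rw [← hAu] at this
    exact this.comp u hA
  have hC : ContDiffAt ℝ ∞ (fun v ↦ (A v).inverse.comp (L.comp ((cross7CLM (sphereParam p₀ v)).comp
      (fderiv ℝ (sphereParam p₀) v)))) u :=
    hinv.clm_comp (contDiffAt_const.clm_comp
      ((cross7CLM.contDiff.contDiffAt.comp u h0).clm_comp h1))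
  refine (hC.differentiableAt (by simp)).congr_of_eventuallyEq ?_
  have hnhds : ∀ᶠ v in 𝓝 u, A v ∈ Set.range ((↑) : (E6 ≃L[ℝ] E6) → E6 →L[ℝ] E6) := by
    refine hA.continuousAt.eventually ?_
    rw [hAu]
    exact ContinuousLinearEquiv.nhds _
  filter_upwards [hnhds, (isOpen_extChartAt_target p₀).mem_nhds hu] with v ⟨e, he⟩ hv
  ext1 w
  have : A v (chartEnd p₀ standardJ v w) =
      L (cross7CLM (sphereParam p₀ v) (fderiv ℝ (sphereParam p₀) v w)) :=
    congrArg L (fderiv_sphereParam_chartEnd hv w)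
  change _ = (A v).inverse (L (cross7CLM (sphereParam p₀ v) (fderiv ℝ (sphereParam p₀) v w)))
  rw [← this, ← he]
  simp

/-- The Nijenhuis tensor of the sphere is computed by differentiating
`P (J x) = φ × P x`, where `φ` is the parametrization and `P` its derivative; the second
derivatives of `φ` cancel by their symmetry. -/
theorem fderiv_sphereParam_nijenhuisChart (hu : u ∈ (extChartAt (𝓡 6) p₀).target) (x y : E6) :
    fderiv ℝ (sphereParam p₀) u (nijenhuisChart (chartEnd p₀ standardJ) u x y) =
      (-4 : ℝ) • cross7 (sphereParam p₀ u)
        (cross7 (fderiv ℝ (sphereParam p₀) u x) (fderiv ℝ (sphereParam p₀) u y)) := by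
  have h0 := contDiffAt_sphereParam hu
  have h1 := h0.differentiableAt (by simp) |>.hasFDerivAt
  have h2 : HasFDerivAt (fderiv ℝ (sphereParam p₀)) _ u :=
    ((h0.fderiv_right (m := ∞) (by simp)).differentiableAt (by simp)).hasFDerivAt
  have hJ := (differentiableAt_chartEnd_standardJ hu).hasFDerivAt
  have hsymm (x y : E6) : fderiv ℝ (fderiv ℝ (sphereParam p₀)) u x y =
      fderiv ℝ (fderiv ℝ (sphereParam p₀)) u y x :=
    (h0.isSymmSndFDerivAt (by
      rw [minSmoothness_of_isRCLikeNormedField]; exact ENat.LEInfty.out)).eq x y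
  have hd (w x : E6) : fderiv ℝ (sphereParam p₀) u (fderiv ℝ (chartEnd p₀ standardJ) u w x) =
      cross7CLM (fderiv ℝ (sphereParam p₀) u w) (fderiv ℝ (sphereParam p₀) u x) +
      cross7CLM (sphereParam p₀ u) (fderiv ℝ (fderiv ℝ (sphereParam p₀)) u w x) -
      fderiv ℝ (fderiv ℝ (sphereParam p₀)) u w (chartEnd p₀ standardJ u x) := by
    have := (h2.clm_apply (hJ.clm_apply (hasFDerivAt_const x u))).apply_eq_of_eqOn
      ((cross7CLM.hasFDerivAt.comp u h1).clm_apply (h2.clm_apply (hasFDerivAt_const x u)))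
      (isOpen_extChartAt_target p₀) hu (fun v hv ↦ fderiv_sphereParam_chartEnd hv x) w
    simp at this
    rw [eq_sub_iff_add_eq, this, add_comm]
  rw [← nijenhuis_cross7 (inner_fderiv_sphereParam hu x) (inner_fderiv_sphereParam hu y)]
  simp only [nijenhuisChart, map_add, map_sub, hd, fderiv_sphereParam_chartEnd hu]
  rw [hsymm y x, hsymm y (chartEnd p₀ standardJ u x), hsymm x (chartEnd p₀ standardJ u y),
    hsymm (chartEnd p₀ standardJ u y) (chartEnd p₀ standardJ u x)]
  simp only [← cross7CLM_apply]
  have : cross7CLM (fderiv ℝ (sphereParam p₀) u y) (fderiv ℝ (sphereParam p₀) u x) =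
    -cross7CLM (fderiv ℝ (sphereParam p₀) u x) (fderiv ℝ (sphereParam p₀) u y) := cross7_swap _ _
  rw [this, map_neg]
  module

theorem nijenhuisChart_standardJ_eq (hu : u ∈ (extChartAt (𝓡 6) p₀).target) {x y z : E6} {c : ℝ}
    (h : cross7 (fderiv ℝ (sphereParam p₀) u x) (fderiv ℝ (sphereParam p₀) u y) =
      c • fderiv ℝ (sphereParam p₀) u z) :
    nijenhuisChart (chartEnd p₀ standardJ) u x y = (-4 * c : ℝ) • chartEnd p₀ standardJ u z := by
  apply fderiv_sphereParam_injective hu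
  rw [fderiv_sphereParam_nijenhuisChart hu, h, map_smul, fderiv_sphereParam_chartEnd hu,
    ← cross7CLM_apply, map_smul, mul_smul]

/-- Apply the cyclic identity to tangent vectors with images `X`, `Y` and `X × Y` in `p^⊥`, where `Y`
is orthogonal to `X` and `p × X`. As in `torsion_eq_zero_of_compatible`, its three terms have the same sign. -/
theorem not_admitsCompatibleSymplecticOn_standardJ {U : Set S6} (hU : IsOpen U) {p : S6}
    (hp : p ∈ U) : ¬ AdmitsCompatibleSymplecticOn standardJ U := by
  rintro ⟨Ω, hΩ, hJΩ⟩
  have hu := mem_extChartAt_target (I := 𝓡 6) p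
  have huU : (extChartAt (𝓡 6) p).symm (extChartAt (𝓡 6) p p) ∈ U := by
    rwa [extChartAt_to_inv]
  set u := extChartAt (𝓡 6) p p
  set P := fderiv ℝ (sphereParam p) u with hP
  have hPinj : ∀ x, x ≠ 0 → P x ≠ 0 := fun x hx ↦
    (map_ne_zero_iff P (fderiv_sphereParam_injective hu)).2 hx
  obtain ⟨x, hx⟩ := exists_ne (0 : E6)
  obtain ⟨Y, hY0, hpY, hXY, hpXY⟩ :=
    exists_ne_zero_inner_eq_zero (sphereParam p u) (P x) (cross7 (sphereParam p u) (P x))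
  obtain ⟨y, rfl⟩ := exists_fderiv_sphereParam_eq hu hpY
  rw [inner_cross7_comm] at hpXY
  obtain ⟨z, hz⟩ := exists_fderiv_sphereParam_eq hu hpXY
  have hy : y ≠ 0 := by rintro rfl; exact hY0 (map_zero _)
  have hxy : nijenhuisChart (chartEnd p standardJ) u x y =
      (-4 * 1 : ℝ) • chartEnd p standardJ u z :=
    nijenhuisChart_standardJ_eq hu (by rw [one_smul, hz])
  have hyz : nijenhuisChart (chartEnd p standardJ) u y z =
      (-4 * ⟪P y, P y⟫ : ℝ) • chartEnd p standardJ u x :=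
    nijenhuisChart_standardJ_eq hu (by
      rw [hz, cross7_swap (P x), ← cross7CLM_apply, map_neg, cross7CLM_apply, cross7_cross7_self,
        real_inner_comm, hXY]
      simp [hP])
  have hzx : nijenhuisChart (chartEnd p standardJ) u z x =
      (-4 * ⟪P x, P x⟫ : ℝ) • chartEnd p standardJ u y :=
    nijenhuisChart_standardJ_eq hu (by
      rw [hz, cross7_swap, cross7_cross7_self, hXY]
      simp [hP])
  have key := hΩ.sum_chartBilin_nijenhuisChart hJΩ hU standardJ_standardJ hu huU
    (differentiableAt_chartEnd_standardJ hu) x y z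
  rw [hxy, hyz, hzx] at key
  simp only [map_smul, smul_apply, smul_eq_mul] at key
  have hneg (v : E6) (hv : v ≠ 0) : chartBilin p Ω u (chartEnd p standardJ u v) v < 0 := by
    have h1 := hJΩ.pos _ huU (chartFrame p u v) fun h0 ↦ hv
      ((chartCoframe_chartFrame hu v).symm.trans
      ((congrArg (chartCoframe p _) h0).trans (map_zero (chartCoframe p _))))
    have h2 := hΩ.skew huU (chartFrame p u v) (standardJ _ (chartFrame p u v))
    rw [chartBilin_apply, chartFrame_chartEnd hu]
    linarith
  have hnonpos : chartBilin p Ω u (chartEnd p standardJ u z) z ≤ 0 := by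
    by_cases hz0 : z = 0
    · rw [hz0, map_zero (chartBilin p Ω u _)]
    · exact (hneg z hz0).le
  have h1 := mul_neg_of_pos_of_neg (real_inner_self_pos.2 (hPinj y hy)) (hneg x hx)
  have h2 := mul_neg_of_pos_of_neg (real_inner_self_pos.2 (hPinj x hx)) (hneg y hy)
  linarith

end Sphere

end

/-! ### Nonexistence of compatible symplectic forms -/

theorem theorem2 :
    (∀ (M : Type*) [TopologicalSpace M] [T2Space M] [ChartedSpace E6 M] [IsManifold (𝓡 6) ∞ M]
      (h : RMetric M) (J : EndField M), IsNearlyKahler h J → ¬ IsIntegrable J →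
        ¬ AdmitsCompatibleSymplecticOn J Set.univ ∧
        (ConnectedSpace M → ∀ p : M, ∀ U : Set M, IsOpen U → p ∈ U →
          ¬ AdmitsCompatibleSymplecticOn J U)) ∧
    (∀ p : S6, ∀ U : Set S6, IsOpen U → p ∈ U →
      ¬ AdmitsCompatibleSymplecticOn standardJ U) := by
  refine ⟨fun M _ _ _ _ h J hNK hJ ↦ ⟨fun hΩ ↦ hJ fun x ↦ ?_, fun _ p U hU hp hΩ ↦ ?_⟩,
    fun p U hU hp ↦ not_admitsCompatibleSymplecticOn_standardJ hU hp⟩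
  · exact hNK.nijenhuisVanishesAt_of_admitsCompatibleSymplecticOn isOpen_univ hΩ (Set.mem_univ x)
  · exact hNK.not_nijenhuisVanishesAt hJ p
      (hNK.nijenhuisVanishesAt_of_admitsCompatibleSymplecticOn hU hΩ hp)
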